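/- **Central identity.** A *1-graph* $g=(V,H,\nu,\iota)$ consists of finite sets $V$ (vertices) and $H$ (half-edges), a map $\nu:H\to V$ and an involution $\iota$ of $H$; two-element orbits of $\iota$ are edges, fixed points are external half-edges. A *2-graph* $G=(V,H,\nu,\iota;S,\mu,\sigma_1,\sigma_2)$ consists of a 1-graph, a finite set $S$ of strand sections, a map $\mu:S\to H$, a fixed-point free involution $\sigma_1$ of $S$ with $\nu\mu\sigma_1=\nu\mu$, and an involution $\sigma_2$ of $S$ with $\mu\sigma_2=\iota\mu$ and $\sigma_2(s)=s\iff\iota(\mu(s))=\mu(s)$. Isomorphisms are tuples of bijections of the sets $V,H$ (and $S$) that commute with all structure maps; unlabelled 1- and 2-graphs are isomorphism classes, and $\mathbf G_1$, $\mathbf G_2$ are the sets of these. The *vertex graph* of $v\in V$ is the 1-graph $g_v=(\nu^{-1}(v),(\nu\mu)^{-1}(v),\mu|,\sigma_1|)$, with class $\gamma_v$. A *subgraph* $K\subset G$ is a 2-graph that differs from $G$ only in that its sets of edges $\{h,\iota h\}$ and of edge strands $\{s,\sigma_2 s\}$ are subsets of those of $G$. The *contraction* $G/K$ has as vertices the connected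 components of $K$ (vertices modulo being joined by edges of $K$), as half-edges and strand sections those external in $K$ (fixed by $\iota_K$, resp. $\sigma_{2,K}$), the edges and edge strands of $G$ not in $K$, and its $\sigma_1$ pairs the two ends of each external face of $K$, i.e. of each chain $s_1\mapsto s_2\mapsto\dots\mapsto s_{2n}$ of distinct strand sections obtained by applying $\sigma_1,\sigma_2,\dots,\sigma_1$ alternately, with $s_1,s_{2n}$ external. A 2-graph is connected if it has exactly one connected component. The *boundary* $\partial\Gamma\in\mathbf G_1$ is the disjoint union of the vertex graphs of $\Gamma/\Gamma$. Let $\mathcal G$ be the $\mathbb Q$-algebra with basis $\mathbf G_2$ and disjoint union as product, let $\Delta:\mathcal G\to\mathcal G\otimes\mathcal G$, $\Delta\Gamma=\sum_{\Theta\subset\Gamma}\Theta\otimes\Gamma/\Theta$, and for $\mathbf P\subset\mathbf G_2$ let $\Delta_{\mathbf P}\Gamma=\sum_{\Theta\subset\Gamma,\ \Theta\in\mathbf P}\Theta\otimes\Gamma/\Theta$. These and products act on formal series coefficientwise. For $\mathbf K\subset\mathbf G_2$ put $$X_{\mathbf K}=\sum_{\Gamma\in\mathbf K}\frac{\Gamma}{|\mathrm{Aut}\,\Gamma|},\qquad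 X=X_{\mathbf G_2},\qquad X^{\gamma}_{\mathbf P}=\sum_{\Gamma\in\mathbf P\text{ connected},\ \partial\Gamma=\gamma}\frac{\Gamma}{|\mathrm{Aut}\,\Gamma|},\qquad X^\gamma=X^\gamma_{\mathbf G_2}.$$ Then all coefficients involved (those of $\Delta_{\mathbf P}$ applied to a formal series and those of finite products of formal series) are finite sums, and: 1. $\displaystyle \Delta X=\sum_{\Gamma\in\mathbf G_2}\Big(\prod_{v\in V_\Gamma}|\mathrm{Aut}\,\gamma_v|\,X^{\gamma_v}\Big)\otimes\frac{\Gamma}{|\mathrm{Aut}\,\Gamma|}.$ 2. For every $\gamma\in\mathbf G_1$: $\displaystyle \Delta X^{\gamma}=\sum_{\Gamma\text{ connected},\ \partial\Gamma=\gamma}\Big(\prod_{v\in V_\Gamma}|\mathrm{Aut}\,\gamma_v|\,X^{\gamma_v}\Big)\otimes\frac{\Gamma}{|\mathrm{Aut}\,\Gamma|}.$ 3. For the set $\mathbf B$ of bridgeless 2-graphs: $\displaystyle \Delta_{\mathbf B} X_{\mathbf B}=\sum_{\Gamma\in\mathbf B}\Big(\prod_{v\in V_\Gamma}|\mathrm{Aut}\,\gamma_v|\,X_{\mathbf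 B}^{\gamma_v}\Big)\otimes\frac{\Gamma}{|\mathrm{Aut}\,\Gamma|}.$ 4. If $\mathbf W\subset\mathbf G_1$ and the set $\mathbf K$ of all 2-graphs with all vertex graphs in $\mathbf W$ is contraction closed ($\Theta\subset\Gamma\in\mathbf K$ implies $\Gamma/\Theta\in\mathbf K$), then $\displaystyle \Delta X_{\mathbf K}=\sum_{\Gamma\in\mathbf K}\Big(\prod_{v\in V_\Gamma}|\mathrm{Aut}\,\gamma_v|\,X_{\mathbf K}^{\gamma_v}\Big)\otimes\frac{\Gamma}{|\mathrm{Aut}\,\Gamma|}.$ 5. In general, let $\mathbf P\subset\mathbf G_2$ contain the empty 2-graph and satisfy $\Gamma\sqcup\Gamma'\in\mathbf P\iff\Gamma,\Gamma'\in\mathbf P$ (for instance $\mathbf P=\mathbf G_2$), and let $\mathbf K\subset\mathbf G_2$ be any set. Then $\displaystyle \Delta_{\mathbf P}X_{\mathbf K}=\sum_{\Gamma\in\mathbf K}\Big(\prod_{v\in V_\Gamma}|\mathrm{Aut}\,\gamma_v|\,X_{\mathbf P}^{\gamma_v}\Big)\otimes\frac{\Gamma}{|\mathrm{Aut}\,\Gamma|}$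 holds if and only if $\mathbf K$ is $\mathbf P$-contraction closed (for $\Theta\subset\Gamma\in\mathbf K$ with $\Theta\in\mathbf P$ also $\Gamma/\Theta\in\mathbf K$) and $\mathbf P$-insertion closed (for $\Theta\subset\Gamma$ with $\Theta\in\mathbf P$ and $\Gamma/\Theta\in\mathbf K$ also $\Gamma\in\mathbf K$). -/

import Mathlib

open scoped TensorProduct

/-! ### Labelled 1-graphs and 2-graphs -/

/-- A 1-graph with vertices `V` and half-edges `H`: an adjacency map `ν` and an involution `ι` on
half-edges. Two-element orbits of `ι` are the edges, fixed points are the external half-edges. -/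
@[ext] structure OneGraph (V H : Type) where
  ν : H → V
  ι : H → H
  ι_ι : ∀ h, ι (ι h) = h

/-- A 2-graph with vertices `V`, half-edges `H` and strand sections `S`. -/
@[ext] structure TwoGraph (V H S : Type) extends OneGraph V H where
  μ : S → H
  σ₁ : S → S
  σ₁_σ₁ : ∀ s, σ₁ (σ₁ s) = s
  σ₁_ne : ∀ s, σ₁ s ≠ s
  ν_μ_σ₁ : ∀ s, ν (μ (σ₁ s)) = ν (μ s)
  σ₂ : S → S
  σ₂_σ₂ : ∀ s, σ₂ (σ₂ s) = s
  μ_σ₂ : ∀ s, μ (σ₂ s) = ι (μ s)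
  σ₂_eq_iff : ∀ s, σ₂ s = s ↔ ι (μ s) = μ s

section Isomorphisms

variable {V H S V' H' S' V'' H'' S'' : Type}

/-- Isomorphisms of 1-graphs. -/
structure OneGraph.Iso (g : OneGraph V H) (g' : OneGraph V' H') where
  toV : V ≃ V'
  toH : H ≃ H'
  map_ν : ∀ h, g'.ν (toH h) = toV (g.ν h)
  map_ι : ∀ h, g'.ι (toH h) = toH (g.ι h)

/-- Isomorphisms of 2-graphs. -/
structure TwoGraph.Iso (G : TwoGraph V H S) (G' : TwoGraph V' H' S') where
  toV : V ≃ V'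
  toH : H ≃ H'
  toS : S ≃ S'
  map_ν : ∀ h, G'.ν (toH h) = toV (G.ν h)
  map_ι : ∀ h, G'.ι (toH h) = toH (G.ι h)
  map_μ : ∀ s, G'.μ (toS s) = toH (G.μ s)
  map_σ₁ : ∀ s, G'.σ₁ (toS s) = toS (G.σ₁ s)
  map_σ₂ : ∀ s, G'.σ₂ (toS s) = toS (G.σ₂ s)

def OneGraph.Iso.refl (g : OneGraph V H) : g.Iso g :=
  ⟨Equiv.refl _, Equiv.refl _, fun _ => rfl, fun _ => rfl⟩

def OneGraph.Iso.symm {g : OneGraph V H} {g' : OneGraph V' H'} (i : g.Iso g') : g'.Iso g where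
  toV := i.toV.symm
  toH := i.toH.symm
  map_ν h := by
    rw [Equiv.eq_symm_apply, ← i.map_ν, Equiv.apply_symm_apply]
  map_ι h := by
    rw [Equiv.eq_symm_apply, ← i.map_ι, Equiv.apply_symm_apply]

def OneGraph.Iso.trans {g : OneGraph V H} {g' : OneGraph V' H'} {g'' : OneGraph V'' H''}
    (i : g.Iso g') (j : g'.Iso g'') : g.Iso g'' where
  toV := i.toV.trans j.toV
  toH := i.toH.trans j.toH
  map_ν h := by simp [j.map_ν, i.map_ν]
  map_ι h := by simp [j.map_ι, i.map_ι]

def TwoGraph.Iso.refl (G : TwoGraph V H S) : G.Iso G :=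
  ⟨Equiv.refl _, Equiv.refl _, Equiv.refl _, fun _ => rfl, fun _ => rfl, fun _ => rfl,
    fun _ => rfl, fun _ => rfl⟩

def TwoGraph.Iso.symm {G : TwoGraph V H S} {G' : TwoGraph V' H' S'} (i : G.Iso G') :
    G'.Iso G where
  toV := i.toV.symm
  toH := i.toH.symm
  toS := i.toS.symm
  map_ν h := by rw [Equiv.eq_symm_apply, ← i.map_ν, Equiv.apply_symm_apply]
  map_ι h := by rw [Equiv.eq_symm_apply, ← i.map_ι, Equiv.apply_symm_apply]
  map_μ h := by rw [Equiv.eq_symm_apply, ← i.map_μ, Equiv.apply_symm_apply]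
  map_σ₁ h := by rw [Equiv.eq_symm_apply, ← i.map_σ₁, Equiv.apply_symm_apply]
  map_σ₂ h := by rw [Equiv.eq_symm_apply, ← i.map_σ₂, Equiv.apply_symm_apply]

def TwoGraph.Iso.trans {G : TwoGraph V H S} {G' : TwoGraph V' H' S'} {G'' : TwoGraph V'' H'' S''}
    (i : G.Iso G') (j : G'.Iso G'') : G.Iso G'' where
  toV := i.toV.trans j.toV
  toH := i.toH.trans j.toH
  toS := i.toS.trans j.toS
  map_ν h := by simp [j.map_ν, i.map_ν]
  map_ι h := by simp [j.map_ι, i.map_ι]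
  map_μ h := by simp [j.map_μ, i.map_μ]
  map_σ₁ h := by simp [j.map_σ₁, i.map_σ₁]
  map_σ₂ h := by simp [j.map_σ₂, i.map_σ₂]

/-- Conjugation: an isomorphism of 1-graphs identifies the automorphisms of both. -/
def OneGraph.Iso.autEquiv {g : OneGraph V H} {g' : OneGraph V' H'} (i : g.Iso g') :
    g.Iso g ≃ g'.Iso g' where
  toFun a := (i.symm.trans a).trans i
  invFun b := (i.trans b).trans i.symm
  left_inv a := by
    cases a; cases i; simp [OneGraph.Iso.trans, OneGraph.Iso.symm, ← Equiv.trans_assoc]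
    simp [Equiv.trans_assoc]
  right_inv a := by
    cases a; cases i; simp [OneGraph.Iso.trans, OneGraph.Iso.symm, ← Equiv.trans_assoc]
    simp [Equiv.trans_assoc]

/-- Conjugation: an isomorphism of 2-graphs identifies the automorphisms of both. -/
def TwoGraph.Iso.autEquiv {G : TwoGraph V H S} {G' : TwoGraph V' H' S'} (i : G.Iso G') :
    G.Iso G ≃ G'.Iso G' where
  toFun a := (i.symm.trans a).trans i
  invFun b := (i.trans b).trans i.symm
  left_inv a := by
    cases a; cases i; simp [TwoGraph.Iso.trans, TwoGraph.Iso.symm, ← Equiv.trans_assoc]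
    simp [Equiv.trans_assoc]
  right_inv a := by
    cases a; cases i; simp [TwoGraph.Iso.trans, TwoGraph.Iso.symm, ← Equiv.trans_assoc]
    simp [Equiv.trans_assoc]

end Isomorphisms

/-! ### Connected components, vertex graphs, bridges -/

section Basic

variable {V H S : Type}

/-- Two vertices are equivalent iff they are joined by a sequence of edges. -/
def OneGraph.joined (g : OneGraph V H) : Setoid V :=
  Relation.EqvGen.setoid (fun v w => ∃ h, g.ν h = v ∧ g.ν (g.ι h) = w)

/-- The set of connected components. -/
def OneGraph.Component (g : OneGraph V H) : Type := Quotient g.joined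

/-- A graph is connected iff it has exactly one connected component;
in particular the empty graph is not connected. -/
def OneGraph.IsConnected (g : OneGraph V H) : Prop := Nonempty V ∧ ∀ v w, g.joined v w

/-- The half-edge `h` belongs to a bridge: it is part of an edge, and deleting that edge
disconnects the two ends of it. -/
def OneGraph.IsBridge (g : OneGraph V H) (h : H) : Prop :=
  g.ι h ≠ h ∧
    ¬ Relation.EqvGen (fun v w => ∃ k, k ≠ h ∧ k ≠ g.ι h ∧ g.ν k = v ∧ g.ν (g.ι k) = w)
      (g.ν h) (g.ν (g.ι h))

/-- The vertex graph at `v`: the half-edges at `v` become vertices, the strand sections at `v`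
become half-edges, paired to edges by `σ₁`. -/
def TwoGraph.vertexGraph (G : TwoGraph V H S) (v : V) :
    OneGraph {h // G.ν h = v} {s // G.ν (G.μ s) = v} where
  ν s := ⟨G.μ s, s.2⟩
  ι s := ⟨G.σ₁ s, (G.ν_μ_σ₁ s).trans s.2⟩
  ι_ι s := Subtype.ext (G.σ₁_σ₁ s)

/-- The disjoint union of all vertex graphs. (The sets `ν⁻¹(v)` partition the half-edges and
the sets `(ν ∘ μ)⁻¹(v)` partition the strand sections.) -/
def TwoGraph.vertexGraphUnion (G : TwoGraph V H S) : OneGraph H S where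
  ν := G.μ
  ι := G.σ₁
  ι_ι := G.σ₁_σ₁

end Basic

/-! ### External faces, subgraphs and contraction -/

namespace TwoGraph

variable {V H S : Type}

/-- The chain of strand sections that starts at `s` and alternates `σ₁, σ₂, σ₁, …`. -/
def strand (G : TwoGraph V H S) (s : S) : ℕ → S
  | 0 => s
  | n + 1 => if Even n then G.σ₁ (G.strand s n) else G.σ₂ (G.strand s n)

/-- There is an external face from `s` to `t`: a chain `s = s₁ ↦ s₂ ↦ … ↦ s₂ₙ = t` (`n ≥ 1`) of
distinct strand sections, each mapped to the next one by `σ₁` and `σ₂` alternating, beginning and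
ending with `σ₁`, with both ends fixed points of `σ₂`. -/
def IsExternalFace (G : TwoGraph V H S) (s t : S) : Prop :=
  G.σ₂ s = s ∧ G.σ₂ t = t ∧
    ∃ n, Set.InjOn (G.strand s) (Set.Iic (2 * n + 1)) ∧ G.strand s (2 * n + 1) = t

/-- A strand chain from an external section cannot repeat before it meets an external section. -/
theorem strand_ne (G : TwoGraph V H S) {s : S} (hs : G.σ₂ s = s) {N : ℕ}
    (hN : ∀ m < N, ¬ Even m → G.σ₂ (G.strand s m) ≠ G.strand s m) :
    ∀ d i, 0 < d → i + d ≤ N → G.strand s i ≠ G.strand s (i + d) := by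
  intro d
  induction d using Nat.strong_induction_on with
  | _ d ih =>
    intro i hd hle heq
    rcases Nat.even_or_odd d with he | ho
    · -- both positions have the same parity: go back to the start
      have back : ∀ j, j ≤ i → G.strand s j = G.strand s (j + d) := fun j hj => by
        obtain ⟨k, rfl⟩ := Nat.exists_eq_add_of_le hj
        clear ih hd hj hle
        induction k with
        | zero => exact heq
        | succ k ihk =>
          apply ihk
          have h1 : G.strand s (j + (k + 1) + d) = G.strand s ((j + k + d) + 1) := by
            congr 1; omega
          rw [h1, ← Nat.add_assoc] at heq
          have hp : Even (j + k + d) ↔ Even (j + k) := by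
            simp [Nat.even_add, he]
          simp only [strand, hp] at heq
          split_ifs at heq
          · have := congrArg G.σ₁ heq
            rwa [G.σ₁_σ₁, G.σ₁_σ₁] at this
          · have := congrArg G.σ₂ heq
            rwa [G.σ₂_σ₂, G.σ₂_σ₂] at this
      have h0 : s = G.strand s d := by
        simpa [strand] using back 0 (Nat.zero_le _)
      obtain ⟨m, rfl⟩ : ∃ m, d = m + 1 := ⟨d - 1, by omega⟩
      have hm : ¬ Even m := by
        intro h; rw [Nat.even_add_one] at he; exact he h
      simp only [strand, if_neg hm] at h0
      refine hN m (by omega) hm ?_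
      have h2 := congrArg G.σ₂ h0
      rw [G.σ₂_σ₂, hs] at h2
      rw [← h0]
      exact h2
    · -- opposite parities: move both positions towards each other
      obtain ⟨m, rfl⟩ : ∃ m, d = m + 1 := ⟨d - 1, by omega⟩
      have hm : Even m := by
        rcases Nat.even_or_odd m with h | h
        · exact h
        · exact absurd ho (by simpa using h.add_one)
      have hp : Even (i + m) ↔ Even i := by simp [Nat.even_add, hm]
      have h3 : G.strand s i = G.strand s ((i + m) + 1) := heq
      simp only [strand, hp] at h3
      have h4 : G.strand s (i + 1) = G.strand s (i + m) := by
        simp only [strand]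
        split_ifs at h3 ⊢
        · rw [h3, G.σ₁_σ₁]
        · rw [h3, G.σ₂_σ₂]
      rcases Nat.eq_zero_or_pos m with rfl | hpos
      · simp only [Nat.add_zero] at h3
        split_ifs at h3 with hi
        · exact G.σ₁_ne _ h3.symm
        · exact hN i (by omega) hi h3.symm
      · obtain ⟨k, rfl⟩ : ∃ k, m = k + 2 := by
          obtain ⟨r, rfl⟩ := hm
          exact ⟨2 * r - 2, by omega⟩
        refine ih (k + 1) (by omega) (i + 1) (by omega) (by omega) ?_
        rw [h4]
        congr 1
        omega

/-- On a finite 2-graph the strand from an external section meets an external section again. -/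
theorem exists_strand_external [Finite S] (G : TwoGraph V H S) {s : S} (hs : G.σ₂ s = s) :
    ∃ m, ¬ Even m ∧ G.σ₂ (G.strand s m) = G.strand s m := by
  by_contra hcon
  push Not at hcon
  have hinj : Function.Injective (G.strand s) := by
    intro i j hij
    by_contra hne
    rcases Nat.lt_or_gt_of_ne hne with h | h
    · obtain ⟨d, rfl⟩ := Nat.exists_eq_add_of_le h.le
      exact G.strand_ne hs (N := i + d) (fun m _ => hcon m) d i (by omega) le_rfl hij
    · obtain ⟨d, rfl⟩ := Nat.exists_eq_add_of_le h.le
      exact G.strand_ne hs (N := j + d) (fun m _ => hcon m) d j (by omega) le_rfl hij.symm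
  exact not_injective_infinite_finite _ hinj

/-- Every external strand section starts an external face. -/
theorem exists_externalFace [Finite S] (G : TwoGraph V H S) {s : S} (hs : G.σ₂ s = s) :
    ∃ t, G.IsExternalFace s t := by
  classical
  have hex := G.exists_strand_external hs
  obtain ⟨hodd, hfix⟩ := Nat.find_spec hex
  have hmin : ∀ m < Nat.find hex, ¬ Even m → G.σ₂ (G.strand s m) ≠ G.strand s m :=
    fun m hm h1 h2 => Nat.find_min hex hm ⟨h1, h2⟩
  obtain ⟨n, hn⟩ : ∃ n, Nat.find hex = 2 * n + 1 := Nat.not_even_iff_odd.mp hodd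
  refine ⟨_, hs, hfix, n, ?_, by rw [hn]⟩
  intro i hi j hj hij
  simp only [Set.mem_Iic] at hi hj
  by_contra hne
  rcases Nat.lt_or_gt_of_ne hne with h | h
  · obtain ⟨d, rfl⟩ := Nat.exists_eq_add_of_le h.le
    exact G.strand_ne hs hmin d i (by omega) (by omega) hij
  · obtain ⟨d, rfl⟩ := Nat.exists_eq_add_of_le h.le
    exact G.strand_ne hs hmin d j (by omega) (by omega) hij.symm

/-- The other end of an external face is determined by its start. -/
theorem IsExternalFace.unique {G : TwoGraph V H S} {s t t' : S}
    (h : G.IsExternalFace s t) (h' : G.IsExternalFace s t') : t = t' := by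
  obtain ⟨_, ht, n, hn, rfl⟩ := h
  obtain ⟨_, ht', n', hn', rfl⟩ := h'
  have key : ∀ {a b : ℕ}, G.σ₂ (G.strand s (2 * a + 1)) = G.strand s (2 * a + 1) →
      Set.InjOn (G.strand s) (Set.Iic (2 * b + 1)) → ¬ a < b := by
    intro a b ha hb hab
    have hodd : ¬ Even (2 * a + 1) := by simp
    have h1 : G.strand s (2 * a + 1 + 1) = G.strand s (2 * a + 1) := by
      conv_lhs => rw [strand]
      rw [if_neg hodd, ha]
    have := hb (by simp only [Set.mem_Iic]; omega) (by simp only [Set.mem_Iic]; omega) h1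
    omega
  have h1 := key ht hn'
  have h2 := key ht' hn
  have : n = n' := by omega
  rw [this]

/-- An external face can be traversed backwards. -/
theorem IsExternalFace.symm {G : TwoGraph V H S} {s t : S}
    (h : G.IsExternalFace s t) : G.IsExternalFace t s := by
  obtain ⟨hs, ht, n, hn, hend⟩ := h
  have rev : ∀ i, i ≤ 2 * n + 1 → G.strand t i = G.strand s (2 * n + 1 - i) := by
    intro i
    induction i with
    | zero => intro _; simp [strand, hend]
    | succ i ih =>
      intro hi
      have ih := ih (by omega)
      obtain ⟨k, hk⟩ : ∃ k, 2 * n + 1 - i = k + 1 := ⟨2 * n - i, by omega⟩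
      have hk' : 2 * n + 1 - (i + 1) = k := by omega
      have hp : Even i ↔ Even k := by
        have : i + k = 2 * n := by omega
        have h2 : Even (i + k) := by rw [this]; simp
        exact Nat.even_add.mp h2
      rw [hk']
      rw [hk] at ih
      simp only [strand] at ih ⊢
      rw [ih]
      simp only [hp]
      split_ifs
      · exact G.σ₁_σ₁ _
      · exact G.σ₂_σ₂ _
  refine ⟨ht, hs, n, ?_, by rw [rev _ le_rfl]; simp [strand]⟩
  intro i hi j hj hij
  simp only [Set.mem_Iic] at hi hj
  rw [rev i hi, rev j hj] at hij
  have := hn (by simp only [Set.mem_Iic]; omega) (by simp only [Set.mem_Iic]; omega) hij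
  omega

/-- The two ends of an external face are distinct. -/
theorem IsExternalFace.ne {G : TwoGraph V H S} {s t : S} (h : G.IsExternalFace s t) : t ≠ s := by
  obtain ⟨_, _, n, hn, hend⟩ := h
  intro hts
  have : G.strand s (2 * n + 1) = G.strand s 0 := by rw [hend, hts]; rfl
  have := hn (by simp) (by simp) this
  omega

/-- All strand sections of a chain lie at vertices of one connected component. -/
theorem joined_strand (G : TwoGraph V H S) (s : S) (n : ℕ) :
    G.joined (G.ν (G.μ (G.strand s n))) (G.ν (G.μ s)) := by
  induction n with
  | zero => exact G.joined.refl _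
  | succ n ih =>
    refine G.joined.trans ?_ ih
    simp only [strand]
    split_ifs
    · rw [G.ν_μ_σ₁]
    · rw [G.μ_σ₂]
      exact Relation.EqvGen.symm _ _ (Relation.EqvGen.rel _ _ ⟨_, rfl, rfl⟩)

/-- The external half-edges. -/
abbrev ExtH (G : TwoGraph V H S) : Type := {h // G.ι h = h}

/-- The external strand sections. -/
abbrev ExtS (G : TwoGraph V H S) : Type := {s // G.σ₂ s = s}

/-- The other end of the external face through an external strand section. -/
noncomputable def faceEnd [Finite S] (G : TwoGraph V H S) (s : G.ExtS) : G.ExtS :=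
  ⟨(G.exists_externalFace s.2).choose, (G.exists_externalFace s.2).choose_spec.2.1⟩

theorem isExternalFace_faceEnd [Finite S] (G : TwoGraph V H S) (s : G.ExtS) :
    G.IsExternalFace s (G.faceEnd s) :=
  (G.exists_externalFace s.2).choose_spec

/-- `K` is a subgraph of `G`: it differs from `G` only in that its sets of edges
`{h, ι h}` and of edge strands `{s, σ₂ s}` are subsets of those of `G`. -/
structure IsSubgraph (K G : TwoGraph V H S) : Prop where
  ν_eq : K.ν = G.ν
  μ_eq : K.μ = G.μ
  σ₁_eq : K.σ₁ = G.σ₁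
  ι_eq : ∀ h, K.ι h ≠ h → K.ι h = G.ι h
  σ₂_eq : ∀ s, K.σ₂ s ≠ s → K.σ₂ s = G.σ₂ s

/-- The type of subgraphs of `G`. -/
abbrev Subgraph (G : TwoGraph V H S) : Type := {K : TwoGraph V H S // K.IsSubgraph G}

theorem IsSubgraph.refl (G : TwoGraph V H S) : G.IsSubgraph G :=
  ⟨rfl, rfl, rfl, fun _ _ => rfl, fun _ _ => rfl⟩

theorem IsSubgraph.ι_external {K G : TwoGraph V H S} (hK : K.IsSubgraph G) {h : H}
    (hh : K.ι h = h) : K.ι (G.ι h) = G.ι h := by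
  by_contra hne
  have h1 := hK.ι_eq _ hne
  rw [G.ι_ι] at h1
  have h2 := congrArg K.ι h1
  rw [K.ι_ι, hh] at h2
  rw [h2, hh] at hne
  exact hne rfl

theorem IsSubgraph.σ₂_external {K G : TwoGraph V H S} (hK : K.IsSubgraph G) {s : S}
    (hs : K.σ₂ s = s) : K.σ₂ (G.σ₂ s) = G.σ₂ s := by
  by_contra hne
  have h1 := hK.σ₂_eq _ hne
  rw [G.σ₂_σ₂] at h1
  have h2 := congrArg K.σ₂ h1
  rw [K.σ₂_σ₂, hs] at h2
  rw [h2, hs] at hne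
  exact hne rfl

/-- The contraction `G / K`: vertices are the connected components of `K`, half-edges and strand
sections are those external in `K`, edges and edge strands are those of `G` that are not in `K`,
and the strands at vertices are the shrunken external faces of `K`. -/
noncomputable def contract [Finite S] (G K : TwoGraph V H S) (hK : K.IsSubgraph G) :
    TwoGraph K.Component K.ExtH K.ExtS where
  ν h := Quotient.mk K.joined (K.ν h)
  ι h := ⟨G.ι h, hK.ι_external h.2⟩
  ι_ι h := Subtype.ext (G.ι_ι h)
  μ s := ⟨K.μ s, (K.σ₂_eq_iff s).1 s.2⟩
  σ₁ := K.faceEnd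
  σ₁_σ₁ s := Subtype.ext <|
    (K.isExternalFace_faceEnd (K.faceEnd s)).unique (K.isExternalFace_faceEnd s).symm
  σ₁_ne s := fun h => (K.isExternalFace_faceEnd s).ne (congrArg Subtype.val h)
  ν_μ_σ₁ s := by
    obtain ⟨_, _, n, _, hend⟩ := K.isExternalFace_faceEnd s
    refine Quotient.sound ?_
    show K.joined (K.ν (K.μ (K.faceEnd s))) (K.ν (K.μ s))
    rw [← hend]
    exact K.joined_strand s _
  σ₂ s := ⟨G.σ₂ s, hK.σ₂_external s.2⟩
  σ₂_σ₂ s := Subtype.ext (G.σ₂_σ₂ s)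
  μ_σ₂ s := Subtype.ext (by
    show K.μ (G.σ₂ s) = G.ι (K.μ s)
    rw [hK.μ_eq, G.μ_σ₂])
  σ₂_eq_iff s := by
    rw [Subtype.ext_iff, Subtype.ext_iff]
    show G.σ₂ s = s ↔ G.ι (K.μ s) = K.μ s
    rw [hK.μ_eq, G.σ₂_eq_iff]

/-- The residue `G / G`. -/
noncomputable def residue [Finite S] (G : TwoGraph V H S) :
    TwoGraph G.Component G.ExtH G.ExtS :=
  G.contract G (IsSubgraph.refl G)

/-- The boundary 1-graph: the union of the vertex graphs of the residue. -/
noncomputable def boundary [Finite S] (G : TwoGraph V H S) : OneGraph G.ExtH G.ExtS :=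
  G.residue.vertexGraphUnion

instance [Finite V] [Finite H] [Finite S] : Finite (TwoGraph V H S) :=
  Finite.of_injective
    (fun G : TwoGraph V H S => (G.ν, G.ι, G.μ, G.σ₁, G.σ₂)) (by
      intro G G' h
      simp only [Prod.mk.injEq] at h
      obtain ⟨h1, h2, h3, h4, h5⟩ := h
      exact TwoGraph.ext h1 h2 h3 h4 h5)

/-- The disjoint union of two 2-graphs. -/
def disjUnion {V' H' S' : Type} (G : TwoGraph V H S) (G' : TwoGraph V' H' S') :
    TwoGraph (V ⊕ V') (H ⊕ H') (S ⊕ S') where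
  ν := Sum.map G.ν G'.ν
  ι := Sum.map G.ι G'.ι
  ι_ι := by rintro (h | h) <;> simp [OneGraph.ι_ι]
  μ := Sum.map G.μ G'.μ
  σ₁ := Sum.map G.σ₁ G'.σ₁
  σ₁_σ₁ := by rintro (h | h) <;> simp [σ₁_σ₁]
  σ₁_ne := by rintro (h | h) <;> simp [σ₁_ne]
  ν_μ_σ₁ := by rintro (h | h) <;> simp [ν_μ_σ₁]
  σ₂ := Sum.map G.σ₂ G'.σ₂
  σ₂_σ₂ := by rintro (h | h) <;> simp [σ₂_σ₂]
  μ_σ₂ := by rintro (h | h) <;> simp [μ_σ₂]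
  σ₂_eq_iff := by rintro (h | h) <;> simp [σ₂_eq_iff]

/-- The empty 2-graph. -/
def emptyGraph : TwoGraph Empty Empty Empty where
  ν := id
  ι := id
  ι_ι _ := rfl
  μ := id
  σ₁ := id
  σ₁_σ₁ _ := rfl
  σ₁_ne s := s.elim
  ν_μ_σ₁ _ := rfl
  σ₂ := id
  σ₂_σ₂ _ := rfl
  μ_σ₂ _ := rfl
  σ₂_eq_iff s := s.elim

end TwoGraph

/-! ### Unlabelled graphs -/

/-- A finite labelled 1-graph. -/
structure FinOneGraph : Type 1 where
  V : Type
  H : Type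
  [finV : Fintype V]
  [finH : Fintype H]
  graph : OneGraph V H

/-- A finite labelled 2-graph. -/
structure FinTwoGraph : Type 1 where
  V : Type
  H : Type
  S : Type
  [finV : Fintype V]
  [finH : Fintype H]
  [finS : Fintype S]
  graph : TwoGraph V H S

attribute [instance] FinOneGraph.finV FinOneGraph.finH
attribute [instance] FinTwoGraph.finV FinTwoGraph.finH FinTwoGraph.finS

instance FinOneGraph.setoid : Setoid FinOneGraph where
  r g g' := Nonempty (g.graph.Iso g'.graph)
  iseqv :=
    ⟨fun g => ⟨OneGraph.Iso.refl g.graph⟩, fun ⟨i⟩ => ⟨i.symm⟩, fun ⟨i⟩ ⟨j⟩ => ⟨i.trans j⟩⟩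

instance FinTwoGraph.setoid : Setoid FinTwoGraph where
  r G G' := Nonempty (G.graph.Iso G'.graph)
  iseqv :=
    ⟨fun G => ⟨TwoGraph.Iso.refl G.graph⟩, fun ⟨i⟩ => ⟨i.symm⟩, fun ⟨i⟩ ⟨j⟩ => ⟨i.trans j⟩⟩

/-- The set of unlabelled (finite) 1-graphs. -/
def G1 : Type 1 := Quotient FinOneGraph.setoid

/-- The set of unlabelled (finite) 2-graphs. -/
def G2 : Type 1 := Quotient FinTwoGraph.setoid

/-- The unlabelled 1-graph of a labelled one. -/
noncomputable def OneGraph.unlabel {V H : Type} [Finite V] [Finite H] (g : OneGraph V H) : G1 :=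
  Quotient.mk _ (@FinOneGraph.mk V H (Fintype.ofFinite V) (Fintype.ofFinite H) g)

/-- The unlabelled 2-graph of a labelled one. -/
noncomputable def TwoGraph.unlabel {V H S : Type} [Finite V] [Finite H] [Finite S]
    (G : TwoGraph V H S) : G2 :=
  Quotient.mk _
    (@FinTwoGraph.mk V H S (Fintype.ofFinite V) (Fintype.ofFinite H) (Fintype.ofFinite S) G)

instance {V H : Type} [Finite V] (g : OneGraph V H) : Finite g.Component :=
  inferInstanceAs (Finite (Quotient g.joined))

namespace G1

/-- The number of automorphisms of an unlabelled 1-graph. -/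
noncomputable def autCard (γ : G1) : ℕ :=
  Quotient.lift (s := FinOneGraph.setoid) (fun g : FinOneGraph => Nat.card (g.graph.Iso g.graph))
    (fun _ _ ⟨i⟩ => Nat.card_congr i.autEquiv) γ

end G1

namespace G2

/-- The number of automorphisms of an unlabelled 2-graph. -/
noncomputable def autCard (Γ : G2) : ℕ :=
  Quotient.lift (s := FinTwoGraph.setoid) (fun G : FinTwoGraph => Nat.card (G.graph.Iso G.graph))
    (fun _ _ ⟨i⟩ => Nat.card_congr i.autEquiv) Γ

/-- Multiplication of unlabelled 2-graphs is disjoint union. -/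
instance : Mul G2 where
  mul := Quotient.map₂
    (fun G G' => ⟨G.V ⊕ G'.V, G.H ⊕ G'.H, G.S ⊕ G'.S, G.graph.disjUnion G'.graph⟩)
    (by
      rintro G₁ G₂ ⟨i⟩ G₁' G₂' ⟨j⟩
      refine ⟨⟨Equiv.sumCongr i.toV j.toV, Equiv.sumCongr i.toH j.toH,
        Equiv.sumCongr i.toS j.toS, ?_, ?_, ?_, ?_, ?_⟩⟩ <;>
      rintro (x | x) <;>
      simp [TwoGraph.disjUnion, i.map_ν, j.map_ν, i.map_ι, j.map_ι, i.map_μ, j.map_μ, i.map_σ₁,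
        j.map_σ₁, i.map_σ₂, j.map_σ₂])

/-- The unit is the empty 2-graph. -/
instance : One G2 where
  one := Quotient.mk _ ⟨Empty, Empty, Empty, TwoGraph.emptyGraph⟩

instance : CommMonoid G2 where
  mul_assoc a b c := by
    induction a using Quotient.inductionOn
    induction b using Quotient.inductionOn
    induction c using Quotient.inductionOn
    refine Quotient.sound ⟨⟨Equiv.sumAssoc _ _ _, Equiv.sumAssoc _ _ _, Equiv.sumAssoc _ _ _,
      ?_, ?_, ?_, ?_, ?_⟩⟩ <;>
    rintro ((x | x) | x) <;> rfl
  one_mul a := by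
    induction a using Quotient.inductionOn with
    | _ G =>
    refine Quotient.sound (s := FinTwoGraph.setoid)
      (a := ⟨Empty ⊕ G.V, Empty ⊕ G.H, Empty ⊕ G.S, TwoGraph.emptyGraph.disjUnion G.graph⟩) (b := G)
      ⟨⟨Equiv.emptySum _ _, Equiv.emptySum _ _, Equiv.emptySum _ _, ?_, ?_, ?_, ?_, ?_⟩⟩ <;>
    rintro (x | x) <;> first | exact x.elim | rfl
  mul_one a := by
    induction a using Quotient.inductionOn with
    | _ G =>
    refine Quotient.sound (s := FinTwoGraph.setoid)
      (a := ⟨G.V ⊕ Empty, G.H ⊕ Empty, G.S ⊕ Empty, G.graph.disjUnion TwoGraph.emptyGraph⟩) (b := G)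
      ⟨⟨Equiv.sumEmpty _ _, Equiv.sumEmpty _ _, Equiv.sumEmpty _ _, ?_, ?_, ?_, ?_, ?_⟩⟩ <;>
    rintro (x | x) <;> first | exact x.elim | rfl
  mul_comm a b := by
    induction a using Quotient.inductionOn
    induction b using Quotient.inductionOn
    refine Quotient.sound ⟨⟨Equiv.sumComm _ _, Equiv.sumComm _ _, Equiv.sumComm _ _,
      ?_, ?_, ?_, ?_, ?_⟩⟩ <;>
    rintro (x | x) <;> rfl

/-- A labelled representative of an unlabelled 2-graph. -/
noncomputable def rep (Γ : G2) : FinTwoGraph := Quotient.out Γ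

/-- The vertices of (a representative of) `Γ`. -/
abbrev Vertex (Γ : G2) : Type := Γ.rep.V

/-- The unlabelled vertex graph `γ_v` at a vertex `v` of `Γ`. -/
noncomputable def vertexGraph (Γ : G2) (v : Γ.Vertex) : G1 :=
  (Γ.rep.graph.vertexGraph v).unlabel

/-- The unlabelled boundary 1-graph of `Γ`. -/
noncomputable def boundary (Γ : G2) : G1 := Γ.rep.graph.boundary.unlabel

/-- The connected unlabelled 2-graphs with boundary `γ`. -/
def connectedWithBoundary (γ : G1) : Set G2 :=
  {Γ | Γ.rep.graph.IsConnected ∧ Γ.boundary = γ}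

/-- The bridgeless unlabelled 2-graphs. -/
def bridgeless : Set G2 := {Γ | ∀ h, ¬ Γ.rep.graph.IsBridge h}

/-- The unlabelled 2-graphs all of whose vertex graphs belong to `W`. -/
def withVertexGraphs (W : Set G1) : Set G2 := {Γ | ∀ v, Γ.vertexGraph v ∈ W}

/-! ### The algebra of 2-graphs, its coproduct, and formal series -/

/-- The `ℚ`-algebra of 2-graphs, with disjoint union as multiplication. -/
abbrev Alg : Type 1 := MonoidAlgebra ℚ G2

noncomputable instance {V H S : Type} [Finite V] [Finite H] [Finite S] (G : TwoGraph V H S) :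
    Fintype G.Subgraph := Fintype.ofFinite _

open Classical in
/-- The coproduct restricted to subgraphs in `P`: the linear map with
`Γ ↦ ∑_{Θ ⊂ Γ, Θ ∈ P} Θ ⊗ Γ/Θ`. -/
noncomputable def coproductOn (P : Set G2) : Alg →ₗ[ℚ] Alg ⊗[ℚ] Alg :=
  (Finsupp.linearCombination ℚ (fun Γ : G2 =>
    ∑ K : Γ.rep.graph.Subgraph,
      if K.1.unlabel ∈ P then
        (MonoidAlgebra.single K.1.unlabel (1 : ℚ) : Alg) ⊗ₜ[ℚ]
          (MonoidAlgebra.single (Γ.rep.graph.contract K.1 K.2).unlabel (1 : ℚ) : Alg)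
      else 0)) ∘ₗ (MonoidAlgebra.coeffLinearEquiv ℚ).toLinearMap

/-- The coproduct `Γ ↦ ∑_{Θ ⊂ Γ} Θ ⊗ Γ/Θ`. -/
noncomputable def coproduct : Alg →ₗ[ℚ] Alg ⊗[ℚ] Alg := coproductOn Set.univ

/-- The coefficient of `Θ ⊗ Γ` in a tensor. -/
noncomputable def tensorCoeff (Θ Γ : G2) : Alg ⊗[ℚ] Alg →ₗ[ℚ] ℚ :=
  LinearMap.mul' ℚ ℚ ∘ₗ TensorProduct.map
    (Finsupp.lapply Θ ∘ₗ (MonoidAlgebra.coeffLinearEquiv ℚ).toLinearMap)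
    (Finsupp.lapply Γ ∘ₗ (MonoidAlgebra.coeffLinearEquiv ℚ).toLinearMap)

/-- Formal series `∑_Γ A(Γ) Γ` of 2-graphs, given by their coefficients. -/
abbrev Series : Type 1 := G2 → ℚ

/-- Formal series `∑_{Θ, Γ} B(Θ, Γ) Θ ⊗ Γ`, given by their coefficients. -/
abbrev TensorSeries : Type 1 := G2 → G2 → ℚ

/-- A linear map `D : Alg → Alg ⊗ Alg` applied to a formal series: the coefficient at `Θ ⊗ Γ'` is
`∑_Γ A(Γ) ·` (the coefficient of `Θ ⊗ Γ'` in `D Γ`). -/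
noncomputable def applySeries (D : Alg →ₗ[ℚ] Alg ⊗[ℚ] Alg) (A : Series) : TensorSeries :=
  fun Θ Γ' => ∑ᶠ Γ : G2, A Γ * tensorCoeff Θ Γ' (D (MonoidAlgebra.single Γ (1 : ℚ)))

/-- The product of a finite family of formal series: the coefficient at `Θ` is the sum of
`∏ᵢ Fᵢ(Tᵢ)` over all families of 2-graphs `Tᵢ` with disjoint union `Θ`. -/
noncomputable def seriesProd {I : Type} [Fintype I] (F : I → Series) : Series :=
  fun Θ => ∑ᶠ T ∈ {T : I → G2 | ∏ i, T i = Θ}, ∏ i, F i (T i)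

open Classical in
/-- The series `∑_{Γ ∈ K} Γ / |Aut Γ|`. -/
noncomputable def weighted (K : Set G2) : Series :=
  fun Γ => if Γ ∈ K then 1 / (Γ.autCard : ℚ) else 0

/-- The formal series `∑_{Γ ∈ K} (∏_{v ∈ V_Γ} |Aut γ_v| Y^{γ_v}) ⊗ Γ / |Aut Γ|`. -/
noncomputable def vertexExpansion (Y : G1 → Series) (K : Set G2) : TensorSeries :=
  fun Θ Γ =>
    seriesProd (fun v : Γ.Vertex => ((Γ.vertexGraph v).autCard : ℚ) • Y (Γ.vertexGraph v)) Θ *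
      weighted K Γ

/-- `K` is `P`-contraction closed: `Θ ⊂ Γ ∈ K` and `Θ ∈ P` imply `Γ/Θ ∈ K`. -/
def ContractionClosed (P K : Set G2) : Prop :=
  ∀ (G : FinTwoGraph) (Θ : G.graph.Subgraph), Θ.1.unlabel ∈ P → G.graph.unlabel ∈ K →
    (G.graph.contract Θ.1 Θ.2).unlabel ∈ K

/-- `K` is `P`-insertion closed: `Θ ⊂ Γ`, `Θ ∈ P` and `Γ/Θ ∈ K` imply `Γ ∈ K`. -/
def InsertionClosed (P K : Set G2) : Prop :=
  ∀ (G : FinTwoGraph) (Θ : G.graph.Subgraph), Θ.1.unlabel ∈ P →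
    (G.graph.contract Θ.1 Θ.2).unlabel ∈ K → G.graph.unlabel ∈ K

/-- `P` contains the empty 2-graph, and a disjoint union of two 2-graphs lies in `P` iff both
do; that is, a 2-graph lies in `P` iff all its connected components do. -/
def ComponentClosed (P : Set G2) : Prop :=
  1 ∈ P ∧ ∀ Γ Γ' : G2, Γ * Γ' ∈ P ↔ Γ ∈ P ∧ Γ' ∈ P

end G2

/-! ### Relabelling 2-graphs -/

/-! The two sides are compared coefficient by coefficient. Fix a labelled 2-graph `K` of class Θ in
`P`, a class Γ, and the family `A` over which the series runs. Both coefficients at Θ ⊗ Γ turn out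
to count labelled 2-graphs `G` on the vertex, half-edge and strand sets of `K` that contain `K` as a
subgraph and have `G/K` of class Γ, each counted with weight 1/|Aut K|.

On the left, consider the bijections that carry `K` onto a subgraph, with quotient Γ, of a
representative of some class in `A`. Grouped by image they number |Aut K| for each subgraph; grouped
by the pulled-back graph they number |Aut| of that class for each `G` (`card_contractsTo_mul`). The
weight 1/|Aut| cancels, and exactly the `G` with class in `A` remain (`applySeries_coproductOn`).

On the right, the product of connected series distributes the components of `K` over the vertices of
Γ (`seriesProd_connected`), and |Aut γ_v| counts the isomorphisms from γ_v to the boundary of the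
component placed at v. Glued over all v, these are the bijections from Γ to the residue `K/K` that
respect ν, μ and σ₁ (`card_sameStars`). Since `G ↦ G/K` is a bijection from the 2-graphs containing
`K` to those that share ν, μ, σ₁ with the residue (`contractEquiv`), there are |Aut Γ| such
bijections for each `G` (`card_contractsTo_mul_autCard`). So all `G` remain if Γ lies in `A`, and
none otherwise (`vertexExpansion_weighted`).

Equality at `K` and Γ therefore says that every such `G` lies in `A` iff Γ does (`coeff_eq_iff`),
which is closure under contraction and insertion. The special cases hold because contraction
preserves connectedness and boundary, because contracting a bridgeless subgraph neither creates nor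
destroys bridges, and because a 2-graph has the same vertex graphs as its subgraphs. -/

theorem TwoGraph.Iso.ext {V H S V' H' S' : Type} {G : TwoGraph V H S} {G' : TwoGraph V' H' S'}
    {i j : G.Iso G'} (hV : ∀ v, i.toV v = j.toV v) (hH : ∀ h, i.toH h = j.toH h)
    (hS : ∀ s, i.toS s = j.toS s) : i = j := by
  cases i; cases j
  simp only [TwoGraph.Iso.mk.injEq]
  exact ⟨Equiv.ext hV, Equiv.ext hH, Equiv.ext hS⟩

theorem OneGraph.Iso.ext {V H V' H' : Type} {G : OneGraph V H} {G' : OneGraph V' H'}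
    {i j : G.Iso G'} (hV : ∀ v, i.toV v = j.toV v) (hH : ∀ h, i.toH h = j.toH h) : i = j := by
  cases i; cases j
  simp only [OneGraph.Iso.mk.injEq]
  exact ⟨Equiv.ext hV, Equiv.ext hH⟩

/-- Composition with an isomorphism identifies sets of isomorphisms. -/
def TwoGraph.Iso.transEquiv {V H S V' H' S' V'' H'' S'' : Type} (G : TwoGraph V H S)
    {G' : TwoGraph V' H' S'} {G'' : TwoGraph V'' H'' S''} (i : G'.Iso G'') :
    G.Iso G' ≃ G.Iso G'' where
  toFun j := j.trans i
  invFun j := j.trans i.symm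
  left_inv _ := TwoGraph.Iso.ext (fun _ => i.toV.symm_apply_apply _)
    (fun _ => i.toH.symm_apply_apply _) (fun _ => i.toS.symm_apply_apply _)
  right_inv _ := TwoGraph.Iso.ext (fun _ => i.toV.apply_symm_apply _)
    (fun _ => i.toH.apply_symm_apply _) (fun _ => i.toS.apply_symm_apply _)

/-- Composition with an isomorphism identifies sets of isomorphisms. -/
def OneGraph.Iso.transEquiv {V H V' H' V'' H'' : Type} (G : OneGraph V H)
    {G' : OneGraph V' H'} {G'' : OneGraph V'' H''} (i : G'.Iso G'') :
    G.Iso G' ≃ G.Iso G'' where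
  toFun j := j.trans i
  invFun j := j.trans i.symm
  left_inv _ := OneGraph.Iso.ext (fun _ => i.toV.symm_apply_apply _)
    (fun _ => i.toH.symm_apply_apply _)
  right_inv _ := OneGraph.Iso.ext (fun _ => i.toV.apply_symm_apply _)
    (fun _ => i.toH.apply_symm_apply _)

namespace TwoGraph

/-- Triples of bijections of vertices, half-edges and strand sections. -/
abbrev Relabeling (V H S V' H' S' : Type) : Type := (V ≃ V') × (H ≃ H') × (S ≃ S')

variable {V H S V' H' S' : Type}

/-- The inverse triple of bijections. -/
def Relabeling.symm (e : Relabeling V H S V' H' S') : Relabeling V' H' S' V H S :=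
  (e.1.symm, e.2.1.symm, e.2.2.symm)

/-- Transport of a 2-graph along bijections. -/
def map (G : TwoGraph V H S) (e : Relabeling V H S V' H' S') : TwoGraph V' H' S' where
  ν h := e.1 (G.ν (e.2.1.symm h))
  ι h := e.2.1 (G.ι (e.2.1.symm h))
  ι_ι h := by simp [G.ι_ι]
  μ s := e.2.1 (G.μ (e.2.2.symm s))
  σ₁ s := e.2.2 (G.σ₁ (e.2.2.symm s))
  σ₁_σ₁ s := by simp [G.σ₁_σ₁]
  σ₁_ne s h := G.σ₁_ne (e.2.2.symm s) (by rw [Equiv.eq_symm_apply, h])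
  ν_μ_σ₁ s := by simp [G.ν_μ_σ₁]
  σ₂ s := e.2.2 (G.σ₂ (e.2.2.symm s))
  σ₂_σ₂ s := by simp [G.σ₂_σ₂]
  μ_σ₂ s := by simp [G.μ_σ₂]
  σ₂_eq_iff s := by
    rw [← Equiv.eq_symm_apply, ← Equiv.eq_symm_apply, Equiv.symm_apply_apply, G.σ₂_eq_iff]

/-- The tautological isomorphism to a transported 2-graph. -/
def mapIso (G : TwoGraph V H S) (e : Relabeling V H S V' H' S') : G.Iso (G.map e) where
  toV := e.1
  toH := e.2.1
  toS := e.2.2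
  map_ν h := by simp [map]
  map_ι h := by simp [map]
  map_μ h := by simp [map]
  map_σ₁ h := by simp [map]
  map_σ₂ h := by simp [map]

theorem Iso.map_eq {G : TwoGraph V H S} {G' : TwoGraph V' H' S'} (i : G.Iso G') :
    G.map (i.toV, i.toH, i.toS) = G' := by
  apply TwoGraph.ext <;> funext x <;>
    simp [map, ← i.map_ν, ← i.map_ι, ← i.map_μ, ← i.map_σ₁, ← i.map_σ₂]

/-- Isomorphisms are bijections that transport one graph to the other. -/
def isoEquivMapEq (G : TwoGraph V H S) (G' : TwoGraph V' H' S') :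
    G.Iso G' ≃ {e : Relabeling V H S V' H' S' // G.map e = G'} where
  toFun i := ⟨(i.toV, i.toH, i.toS), i.map_eq⟩
  invFun e :=
    { toV := e.1.1
      toH := e.1.2.1
      toS := e.1.2.2
      map_ν := by obtain ⟨e, rfl⟩ := e; exact (G.mapIso e).map_ν
      map_ι := by obtain ⟨e, rfl⟩ := e; exact (G.mapIso e).map_ι
      map_μ := by obtain ⟨e, rfl⟩ := e; exact (G.mapIso e).map_μ
      map_σ₁ := by obtain ⟨e, rfl⟩ := e; exact (G.mapIso e).map_σ₁
      map_σ₂ := by obtain ⟨e, rfl⟩ := e; exact (G.mapIso e).map_σ₂ }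
  left_inv i := rfl
  right_inv e := rfl

@[simp] theorem map_symm_map (G : TwoGraph V H S) (e : Relabeling V H S V' H' S') :
    (G.map e).map e.symm = G := by
  apply TwoGraph.ext <;> funext x <;> simp [map, Relabeling.symm]

@[simp] theorem map_map_symm (G : TwoGraph V H S) (e : Relabeling V' H' S' V H S) :
    (G.map e.symm).map e = G := by
  apply TwoGraph.ext <;> funext x <;> simp [map, Relabeling.symm]

/-- The bijections that transport `G` into the set `A` form torsors over `Aut G`. -/
theorem card_map_mem (G : TwoGraph V H S) (A : Set (TwoGraph V' H' S')) :
    Nat.card {e : Relabeling V H S V' H' S' // G.map e ∈ A} =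
      Nat.card {G' : TwoGraph V' H' S' // G' ∈ A ∧ Nonempty (G.Iso G')} *
        Nat.card (G.Iso G) := by
  rw [← Nat.card_prod]
  let f : {e : Relabeling V H S V' H' S' // G.map e ∈ A} →
      {G' : TwoGraph V' H' S' // G' ∈ A ∧ Nonempty (G.Iso G')} :=
    fun e => ⟨G.map e.1, e.2, ⟨G.mapIso e.1⟩⟩
  -- The fiber over `G'` is the set of isomorphisms from `G` to `G'`; composing with the inverse of
  -- a chosen one identifies it with Aut `G`, so all fibers have the same size.
  have fiber : ∀ G', {e // f e = G'} ≃ G.Iso G'.1 := fun G' =>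
    Equiv.trans
      { toFun := fun e => ⟨e.1.1, congrArg Subtype.val e.2⟩
        invFun := fun e => ⟨⟨e.1, by rw [e.2]; exact G'.2.1⟩, Subtype.ext e.2⟩
        left_inv := fun _ => rfl
        right_inv := fun _ => rfl }
      (isoEquivMapEq G G'.1).symm
  exact Nat.card_congr <| (Equiv.sigmaFiberEquiv f).symm.trans <|
    (Equiv.sigmaCongrRight fun G' =>
      (fiber G').trans (TwoGraph.Iso.transEquiv G G'.2.2.some.symm)).trans
    (Equiv.sigmaEquivProd _ _)

end TwoGraph

/-! ### Isomorphism classes -/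

instance {V H V' H' : Type} [Finite V] [Finite V'] [Finite H] [Finite H'] (g : OneGraph V H)
    (g' : OneGraph V' H') : Finite (g.Iso g') :=
  Finite.of_injective (fun i => (i.toV, i.toH)) fun i j h => by
    cases i; cases j; simp_all

instance {V H S V' H' S' : Type} [Finite V] [Finite V'] [Finite H] [Finite H'] [Finite S]
    [Finite S'] (G : TwoGraph V H S) (G' : TwoGraph V' H' S') : Finite (G.Iso G') :=
  Finite.of_injective (fun i => (i.toV, i.toH, i.toS)) fun i j h => by
    cases i; cases j; simp_all

namespace OneGraph

variable {V H V' H' : Type} [Finite V] [Finite H] [Finite V'] [Finite H']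

theorem unlabel_eq_iff {g : OneGraph V H} {g' : OneGraph V' H'} :
    g.unlabel = g'.unlabel ↔ Nonempty (g.Iso g') :=
  Quotient.eq (r := FinOneGraph.setoid)

end OneGraph

namespace TwoGraph

variable {V H S V' H' S' : Type} [Finite V] [Finite H] [Finite S] [Finite V'] [Finite H']
  [Finite S']

theorem unlabel_eq_iff {G : TwoGraph V H S} {G' : TwoGraph V' H' S'} :
    G.unlabel = G'.unlabel ↔ Nonempty (G.Iso G') :=
  Quotient.eq (r := FinTwoGraph.setoid)

theorem Iso.unlabel_eq {G : TwoGraph V H S} {G' : TwoGraph V' H' S'} (i : G.Iso G') :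
    G.unlabel = G'.unlabel :=
  unlabel_eq_iff.2 ⟨i⟩

theorem unlabel_mul_unlabel (G : TwoGraph V H S) (G' : TwoGraph V' H' S') :
    G.unlabel * G'.unlabel = (G.disjUnion G').unlabel :=
  Quotient.sound (s := FinTwoGraph.setoid) ⟨Iso.refl _⟩

theorem card_iso_pos (G : TwoGraph V H S) : 0 < Nat.card (G.Iso G) :=
  Nat.card_pos_iff.2 ⟨⟨Iso.refl G⟩, inferInstance⟩

end TwoGraph

namespace G2

theorem unlabel_rep (Γ : G2) : Γ.rep.graph.unlabel = Γ := by
  conv_rhs => rw [← Quotient.out_eq Γ]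
  exact Quotient.sound (s := FinTwoGraph.setoid) ⟨TwoGraph.Iso.refl _⟩

theorem exists_iso_rep {V H S : Type} [Finite V] [Finite H] [Finite S] (G : TwoGraph V H S) :
    Nonempty (G.Iso G.unlabel.rep.graph) :=
  TwoGraph.unlabel_eq_iff.1 (unlabel_rep _).symm

theorem autCard_eq (Γ : G2) : Γ.autCard = Nat.card (Γ.rep.graph.Iso Γ.rep.graph) := by
  conv_lhs => rw [← unlabel_rep Γ]
  rfl

theorem autCard_pos (Γ : G2) : 0 < Γ.autCard := by
  rw [autCard_eq]
  exact TwoGraph.card_iso_pos _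

theorem one_eq_unlabel : (1 : G2) = TwoGraph.emptyGraph.unlabel :=
  Quotient.sound (s := FinTwoGraph.setoid) ⟨TwoGraph.Iso.refl _⟩

end G2

/-! ### Maps out of the equivalence relation generated by edges -/

theorem Relation.EqvGen.lift_setoid {α β : Type} {r : α → α → Prop} (s : Setoid β) (f : α → β)
    (h : ∀ a b, r a b → s (f a) (f b)) {a b : α} (hab : Relation.EqvGen r a b) :
    s (f a) (f b) := by
  induction hab with
  | rel a b hab => exact h a b hab
  | refl a => exact s.refl _
  | symm a b _ ih => exact s.symm ih
  | trans a b c _ _ ih₁ ih₂ => exact s.trans ih₁ ih₂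

theorem OneGraph.joined_edge {V H : Type} (g : OneGraph V H) (h : H) :
    g.joined (g.ν h) (g.ν (g.ι h)) :=
  Relation.EqvGen.rel _ _ ⟨h, rfl, rfl⟩

/-- The form in which connectedness is used throughout: with `s = ⊥`, a function constant along
edges is constant on components; with `s` the relation `joined` of another graph, a map that
respects edges respects components. -/
theorem OneGraph.joined_lift {V H β : Type} {g : OneGraph V H} {v w : V} (hvw : g.joined v w)
    (s : Setoid β) (f : V → β) (h : ∀ h, s (f (g.ν h)) (f (g.ν (g.ι h)))) : s (f v) (f w) :=
  Relation.EqvGen.lift_setoid s f (by rintro _ _ ⟨k, rfl, rfl⟩; exact h k) hvw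

namespace TwoGraph

variable {V H S V' H' S' : Type}

/-! ### External faces via reachability -/

/-- `t` is obtained from `s` by repeatedly applying `σ₁` and `σ₂`. -/
def Reach (G : TwoGraph V H S) : S → S → Prop :=
  Relation.ReflTransGen fun a b => b = G.σ₁ a ∨ b = G.σ₂ a

theorem Reach.lift {G : TwoGraph V H S} {G' : TwoGraph V' H' S'} (f : S → S')
    (h₁ : ∀ s, G'.Reach (f s) (f (G.σ₁ s))) (h₂ : ∀ s, G'.Reach (f s) (f (G.σ₂ s))) {s t : S}
    (h : G.Reach s t) : G'.Reach (f s) (f t) := by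
  induction h with
  | refl => exact Relation.ReflTransGen.refl
  | tail _ hbc ih =>
    rcases hbc with rfl | rfl
    · exact ih.trans (h₁ _)
    · exact ih.trans (h₂ _)

theorem reach_σ₁ (G : TwoGraph V H S) (s : S) : G.Reach s (G.σ₁ s) :=
  Relation.ReflTransGen.single (Or.inl rfl)

theorem reach_σ₂ (G : TwoGraph V H S) (s : S) : G.Reach s (G.σ₂ s) :=
  Relation.ReflTransGen.single (Or.inr rfl)

theorem reach_strand (G : TwoGraph V H S) (s : S) (n : ℕ) : G.Reach s (G.strand s n) := by
  induction n with
  | zero => exact Relation.ReflTransGen.refl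
  | succ n ih =>
    refine ih.trans ?_
    simp only [strand]
    split_ifs
    · exact G.reach_σ₁ _
    · exact G.reach_σ₂ _

theorem IsExternalFace.reach {G : TwoGraph V H S} {s t : S} (h : G.IsExternalFace s t) :
    G.Reach s t := by
  obtain ⟨_, _, n, _, rfl⟩ := h
  exact G.reach_strand s _

/-- An external section reachable from the start of an external face is one of its two ends. -/
theorem IsExternalFace.eq_of_reach {G : TwoGraph V H S} {s t u : S} (h : G.IsExternalFace s t)
    (hu : G.σ₂ u = u) (hsu : G.Reach s u) : u = s ∨ u = t := by
  obtain ⟨hs, ht, n, hn, hend⟩ := h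
  have inj : ∀ i j, i ≤ 2 * n + 1 → j ≤ 2 * n + 1 → G.strand s i = G.strand s j → i = j :=
    fun i j hi hj hij => hn (Set.mem_Iic.2 hi) (Set.mem_Iic.2 hj) hij
  have odd : ∀ i, ¬ Even i → G.strand s (i + 1) = G.σ₂ (G.strand s i) := fun i hi => by
    rw [strand, if_neg hi]
  have even : ∀ i, Even i → G.strand s (i + 1) = G.σ₁ (G.strand s i) := fun i hi => by
    rw [strand, if_pos hi]
  -- The chain is stable under both involutions: each of them moves a section to a neighbour in the
  -- chain, except that `σ₂` fixes the two ends. Hence everything reachable from `s` lies on the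
  -- chain.
  have key : ∃ i ≤ 2 * n + 1, G.strand s i = u := by
    clear hu
    induction hsu with
    | refl => exact ⟨0, by omega, rfl⟩
    | tail _ hbc ih =>
      obtain ⟨i, hi, rfl⟩ := ih
      by_cases he : Even i
      · rcases hbc with rfl | rfl
        · refine ⟨i + 1, ?_, even i he⟩
          obtain ⟨k, rfl⟩ := he
          omega
        · rcases i with _ | j
          · exact ⟨0, by omega, hs.symm⟩
          · have hj : ¬ Even j := by rwa [Nat.even_add_one] at he
            exact ⟨j, by omega, by rw [odd j hj, G.σ₂_σ₂]⟩
      · rcases hbc with rfl | rfl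
        · rcases i with _ | j
          · exact absurd Even.zero he
          · have hj : Even j := by rwa [Nat.even_add_one, not_not] at he
            exact ⟨j, by omega, by rw [even j hj, G.σ₁_σ₁]⟩
        · rcases hi.eq_or_lt with rfl | hlt
          · exact ⟨2 * n + 1, le_rfl, by rw [hend, ht]⟩
          · exact ⟨i + 1, hlt, odd i he⟩
  obtain ⟨i, hi, rfl⟩ := key
  -- At an interior position `σ₂` moves to a neighbour, which is a different section by injectivity,
  -- so only the two ends are external.
  by_cases he : Even i
  · rcases i with _ | j
    · exact Or.inl rfl
    · have hj : ¬ Even j := by rwa [Nat.even_add_one] at he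
      rw [odd j hj, G.σ₂_σ₂] at hu
      have := inj j (j + 1) (by omega) hi (by rw [odd j hj, ← hu])
      omega
  · rcases hi.eq_or_lt with rfl | hlt
    · exact Or.inr hend
    · have := inj (i + 1) i hlt hi (by rw [odd i he, hu])
      omega

/-- The face starting at `s` has no reachable external sections besides its ends, so a second one
must be its other end. Faces can thus be compared by reachability alone, which passes through maps
one step at a time, without control of parity or distinctness. -/
theorem isExternalFace_of_reach [Finite S] {G : TwoGraph V H S} {s t : S} (hs : G.σ₂ s = s)
    (ht : G.σ₂ t = t) (hne : t ≠ s) (h : G.Reach s t) : G.IsExternalFace s t := by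
  obtain ⟨u, hu⟩ := G.exists_externalFace hs
  obtain rfl := (hu.eq_of_reach ht h).resolve_left hne
  exact hu

/-- An injective map of external strand sections that respects reachability respects external
faces. -/
theorem faceEnd_comm [Finite S] [Finite S'] {G : TwoGraph V H S} {G' : TwoGraph V' H' S'}
    (j : G.ExtS → G'.ExtS) (hj : Function.Injective j)
    (hr : ∀ s t : G.ExtS, G.Reach s t → G'.Reach (j s) (j t)) (s : G.ExtS) :
    G'.faceEnd (j s) = j (G.faceEnd s) := by
  have h := G.isExternalFace_faceEnd s
  refine Subtype.ext ((G'.isExternalFace_faceEnd (j s)).unique ?_)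
  refine isExternalFace_of_reach (j s).2 (j _).2 (fun heq => ?_) (hr _ _ h.reach)
  exact h.ne (congrArg Subtype.val (hj (Subtype.ext heq)))

theorem Iso.reach {G : TwoGraph V H S} {G' : TwoGraph V' H' S'} (i : G.Iso G') {s t : S}
    (h : G.Reach s t) : G'.Reach (i.toS s) (i.toS t) :=
  h.lift i.toS (fun s => by rw [← i.map_σ₁]; exact G'.reach_σ₁ _)
    (fun s => by rw [← i.map_σ₂]; exact G'.reach_σ₂ _)

/-! ### Invariance of components, contraction and boundary under isomorphisms -/

/-- The bijection of external half-edges induced by an isomorphism. -/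
def Iso.extH {G : TwoGraph V H S} {G' : TwoGraph V' H' S'} (i : G.Iso G') : G.ExtH ≃ G'.ExtH :=
  i.toH.subtypeEquiv fun h => by rw [i.map_ι, i.toH.apply_eq_iff_eq]

/-- The bijection of external strand sections induced by an isomorphism. -/
def Iso.extS {G : TwoGraph V H S} {G' : TwoGraph V' H' S'} (i : G.Iso G') : G.ExtS ≃ G'.ExtS :=
  i.toS.subtypeEquiv fun h => by rw [i.map_σ₂, i.toS.apply_eq_iff_eq]

theorem Iso.joined {G : TwoGraph V H S} {G' : TwoGraph V' H' S'} (i : G.Iso G') {v w : V}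
    (h : G.joined v w) : G'.joined (i.toV v) (i.toV w) :=
  OneGraph.joined_lift h G'.joined i.toV fun h => by
    rw [← i.map_ν, ← i.map_ν, ← i.map_ι]
    exact G'.joined_edge _

theorem Iso.joined_iff {G : TwoGraph V H S} {G' : TwoGraph V' H' S'} (i : G.Iso G') {v w : V} :
    G'.joined (i.toV v) (i.toV w) ↔ G.joined v w :=
  ⟨fun h => by simpa [Iso.symm] using i.symm.joined h, i.joined⟩

/-- The bijection of connected components induced by an isomorphism. -/
def Iso.component {G : TwoGraph V H S} {G' : TwoGraph V' H' S'} (i : G.Iso G') :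
    G.Component ≃ G'.Component :=
  Quotient.congr i.toV fun _ _ => i.joined_iff.symm

theorem Iso.isConnected {G : TwoGraph V H S} {G' : TwoGraph V' H' S'} (i : G.Iso G')
    (h : G.IsConnected) : G'.IsConnected := by
  refine ⟨h.1.map i.toV, fun v w => ?_⟩
  have := i.joined (h.2 (i.toV.symm v) (i.toV.symm w))
  simpa using this

theorem Iso.faceEnd [Finite S] [Finite S'] {G : TwoGraph V H S} {G' : TwoGraph V' H' S'}
    (i : G.Iso G') (s : G.ExtS) : G'.faceEnd (i.extS s) = i.extS (G.faceEnd s) :=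
  faceEnd_comm i.extS i.extS.injective (fun _ _ h => i.reach h) s

/-- Contraction commutes with isomorphisms. -/
def contractIso [Finite S] [Finite S'] {G K : TwoGraph V H S} {G' K' : TwoGraph V' H' S'}
    (hK : K.IsSubgraph G) (hK' : K'.IsSubgraph G') (i : G.Iso G') (j : K.Iso K')
    (hH : i.toH = j.toH) (hS : i.toS = j.toS) :
    (G.contract K hK).Iso (G'.contract K' hK') where
  toV := j.component
  toH := j.extH
  toS := j.extS
  map_ν h := congrArg (Quotient.mk K'.joined) (j.map_ν h)
  map_ι h := Subtype.ext (by
    show G'.ι (j.toH h) = j.toH (G.ι h)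
    rw [← hH, i.map_ι])
  map_μ s := Subtype.ext (j.map_μ s)
  map_σ₁ s := j.faceEnd s
  map_σ₂ s := Subtype.ext (by
    show G'.σ₂ (j.toS s) = j.toS (G.σ₂ s)
    rw [← hS, i.map_σ₂])

/-- The boundary commutes with isomorphisms. -/
def Iso.boundary [Finite S] [Finite S'] {G : TwoGraph V H S} {G' : TwoGraph V' H' S'}
    (i : G.Iso G') : G.boundary.Iso G'.boundary where
  toV := i.extH
  toH := i.extS
  map_ν s := Subtype.ext (i.map_μ s)
  map_ι s := i.faceEnd s

/-- Vertex graphs commute with isomorphisms. -/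
def Iso.vertexGraph {G : TwoGraph V H S} {G' : TwoGraph V' H' S'} (i : G.Iso G') (v : V) :
    (G.vertexGraph v).Iso (G'.vertexGraph (i.toV v)) where
  toV := i.toH.subtypeEquiv fun h => by rw [i.map_ν, i.toV.apply_eq_iff_eq]
  toH := i.toS.subtypeEquiv fun s => by rw [i.map_μ, i.map_ν, i.toV.apply_eq_iff_eq]
  map_ν s := Subtype.ext (i.map_μ s)
  map_ι s := Subtype.ext (i.map_σ₁ s)

/-! ### Contraction preserves connectedness and the boundary -/

section Contract

variable {G K : TwoGraph V H S}

theorem IsSubgraph.joined (hK : K.IsSubgraph G) {v w : V} (h : K.joined v w) :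
    G.joined v w :=
  OneGraph.joined_lift h G.joined id fun h => by
    by_cases hh : K.ι h = h
    · rw [hh]
    · rw [hK.ι_eq h hh, hK.ν_eq]
      exact G.joined_edge h

theorem IsSubgraph.ι_fixed (hK : K.IsSubgraph G) {h : H} (hh : G.ι h = h) : K.ι h = h := by
  by_contra hne
  exact hne ((hK.ι_eq h hne).trans hh)

theorem IsSubgraph.σ₂_fixed (hK : K.IsSubgraph G) {s : S} (hs : G.σ₂ s = s) : K.σ₂ s = s := by
  by_contra hne
  exact hne ((hK.σ₂_eq s hne).trans hs)

theorem IsSubgraph.reach (hK : K.IsSubgraph G) {s t : S} (h : K.Reach s t) : G.Reach s t :=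
  h.lift id (fun s => by rw [hK.σ₁_eq]; exact G.reach_σ₁ s) fun s => by
    by_cases hs : K.σ₂ s = s
    · rw [hs]
      exact Relation.ReflTransGen.refl
    · rw [hK.σ₂_eq s hs]
      exact G.reach_σ₂ s

/-- An edge of `G` either lies in `K`, and then its ends become the same vertex of the contraction,
or consists of half-edges external in `K`, and then it survives as an edge. -/
theorem contract_joined_iff [Finite S] (hK : K.IsSubgraph G) {v w : V} :
    (G.contract K hK).joined (Quotient.mk K.joined v) (Quotient.mk K.joined w) ↔
      G.joined v w := by
  constructor
  · intro h
    let f : K.Component → G.Component := Quotient.map id fun _ _ h => hK.joined h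
    have := OneGraph.joined_lift h (⊥ : Setoid G.Component) f fun h => by
      refine Quotient.sound ?_
      show G.joined (K.ν h) (K.ν (G.ι h))
      rw [hK.ν_eq]
      exact G.joined_edge _
    exact Quotient.exact this
  · intro h
    refine OneGraph.joined_lift h (G.contract K hK).joined (Quotient.mk K.joined) fun h => ?_
    by_cases hh : K.ι h = h
    · have := (G.contract K hK).joined_edge ⟨h, hh⟩
      change (G.contract K hK).joined (Quotient.mk K.joined (K.ν h))
        (Quotient.mk K.joined (K.ν (G.ι h))) at this
      rwa [hK.ν_eq] at this
    · have : Quotient.mk K.joined (G.ν h) = Quotient.mk K.joined (G.ν (G.ι h)) := by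
        rw [← hK.ν_eq, ← hK.ι_eq h hh]
        exact Quotient.sound (K.joined_edge h)
      rw [this]
      exact (G.contract K hK).joined.refl _

theorem contract_isConnected_iff [Finite S] (hK : K.IsSubgraph G) :
    (G.contract K hK).IsConnected ↔ G.IsConnected := by
  constructor
  · rintro ⟨⟨c⟩, h⟩
    exact ⟨⟨Quotient.out c⟩, fun v w => (contract_joined_iff hK).1 (h _ _)⟩
  · rintro ⟨⟨v⟩, h⟩
    refine ⟨⟨Quotient.mk K.joined v⟩, fun a b => ?_⟩
    induction a using Quotient.inductionOn
    induction b using Quotient.inductionOn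
    exact (contract_joined_iff hK).2 (h _ _)

/-- One `σ₁` step in the contraction is a whole external face of `K`, hence a walk in `G`. Through
`faceEnd_comm` this makes the external faces of `G/K` agree with those of `G`. -/
theorem contract_reach [Finite S] (hK : K.IsSubgraph G) {s t : K.ExtS}
    (h : (G.contract K hK).Reach s t) : G.Reach s.1 t.1 :=
  h.lift Subtype.val (fun s => hK.reach (K.isExternalFace_faceEnd s).reach)
    fun s => G.reach_σ₂ s.1

/-- Contraction does not change the boundary. -/
def contractBoundaryIso [Finite S] (hK : K.IsSubgraph G) :
    (G.contract K hK).boundary.Iso G.boundary where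
  toV :=
    { toFun := fun h => ⟨h.1.1, congrArg Subtype.val h.2⟩
      invFun := fun h => ⟨⟨h.1, hK.ι_fixed h.2⟩, Subtype.ext h.2⟩
      left_inv := fun _ => rfl
      right_inv := fun _ => rfl }
  toH :=
    { toFun := fun s => ⟨s.1.1, congrArg Subtype.val s.2⟩
      invFun := fun s => ⟨⟨s.1, hK.σ₂_fixed s.2⟩, Subtype.ext s.2⟩
      left_inv := fun _ => rfl
      right_inv := fun _ => rfl }
  map_ν s := Subtype.ext (by
    show G.μ s.1.1 = K.μ s.1.1
    rw [hK.μ_eq])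
  map_ι s := faceEnd_comm (G := G.contract K hK)
    (fun s => (⟨s.1.1, congrArg Subtype.val s.2⟩ : G.ExtS))
    (fun s t h => Subtype.ext (Subtype.ext (congrArg (fun x : G.ExtS => x.1) h)))
    (fun _ _ h => contract_reach hK h) s

end Contract

end TwoGraph

/-! ### Double counting of embeddings -/

namespace TwoGraph

variable {V H S V' H' S' : Type}

theorem IsSubgraph.map {G K : TwoGraph V H S} (hK : K.IsSubgraph G)
    (e : Relabeling V H S V' H' S') : (K.map e).IsSubgraph (G.map e) where
  ν_eq := by funext h; simp [TwoGraph.map, hK.ν_eq]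
  μ_eq := by funext h; simp [TwoGraph.map, hK.μ_eq]
  σ₁_eq := by funext h; simp [TwoGraph.map, hK.σ₁_eq]
  ι_eq h hh := congrArg e.2.1 (hK.ι_eq _ fun h' => hh (by simp [TwoGraph.map, h']))
  σ₂_eq s hs := congrArg e.2.2 (hK.σ₂_eq _ fun s' => hs (by simp [TwoGraph.map, s']))

variable [Finite V] [Finite H] [Finite S] [Finite V'] [Finite H']
  [Finite S']

/-- `K` is a subgraph of `G` and the contraction `G / K` has isomorphism class `Γ`. -/
def ContractsTo (G K : TwoGraph V H S) (Γ : G2) : Prop :=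
  ∃ hK : K.IsSubgraph G, (G.contract K hK).unlabel = Γ

theorem ContractsTo.map {G K : TwoGraph V H S} {Γ : G2} (h : G.ContractsTo K Γ)
    (e : Relabeling V H S V' H' S') : (G.map e).ContractsTo (K.map e) Γ := by
  obtain ⟨hK, rfl⟩ := h
  exact ⟨hK.map e, ((contractIso hK (hK.map e) (G.mapIso e) (K.mapIso e) rfl rfl).unlabel_eq).symm⟩

theorem contractsTo_map_iff {G : TwoGraph V' H' S'} {K : TwoGraph V H S} {Γ : G2}
    (e : Relabeling V H S V' H' S') :
    G.ContractsTo (K.map e) Γ ↔ (G.map e.symm).ContractsTo K Γ :=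
  ⟨fun h => by simpa using h.map e.symm, fun h => by simpa using h.map e⟩

/-- Counting embeddings of `K` into `G` from both sides. -/
theorem card_contractsTo_mul (G : TwoGraph V' H' S') (K : TwoGraph V H S) (Γ : G2) :
    Nat.card {K' : TwoGraph V' H' S' // G.ContractsTo K' Γ ∧ K'.unlabel = K.unlabel} *
        Nat.card (K.Iso K) =
      Nat.card {G' : TwoGraph V H S // G'.ContractsTo K Γ ∧ G'.unlabel = G.unlabel} *
        Nat.card (G.Iso G) := by
  -- Both products count the bijections `e` for which `K.map e` is a subgraph of `G` with quotient
  -- Γ: the first grouped by `K.map e`, the second by the pulled-back graph `G.map e.symm`, which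
  -- contains `K`.
  have h₁ := card_map_mem K {K' : TwoGraph V' H' S' | G.ContractsTo K' Γ}
  have h₂ := card_map_mem G {G' : TwoGraph V H S | G'.ContractsTo K Γ}
  simp only [Set.mem_ofPred_eq, ← unlabel_eq_iff] at h₁ h₂
  simp only [eq_comm (a := TwoGraph.unlabel K), eq_comm (a := TwoGraph.unlabel G)] at h₁ h₂
  rw [← h₁, ← h₂]
  exact Nat.card_congr
    { toFun := fun e => ⟨e.1.symm, (contractsTo_map_iff e.1).1 e.2⟩
      invFun := fun e => ⟨e.1.symm, (contractsTo_map_iff e.1.symm).2 e.2⟩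
      left_inv := fun _ => rfl
      right_inv := fun _ => rfl }

end TwoGraph

/-! ### Coefficients of the coproduct of a weighted series -/

namespace G2

open Classical in
theorem tensorCoeff_single_tmul_single (Θ Γ' Θ₁ Γ₁ : G2) :
    tensorCoeff Θ Γ' ((MonoidAlgebra.single Θ₁ (1 : ℚ) : Alg) ⊗ₜ[ℚ]
      (MonoidAlgebra.single Γ₁ (1 : ℚ) : Alg)) = if Θ₁ = Θ ∧ Γ₁ = Γ' then 1 else 0 := by
  have h : ∀ Γ₁ Γ₂ : G2, (Finsupp.lapply Γ₂ ∘ₗ (MonoidAlgebra.coeffLinearEquiv ℚ).toLinearMap)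
      (MonoidAlgebra.single Γ₁ (1 : ℚ)) = if Γ₁ = Γ₂ then (1 : ℚ) else 0 :=
    fun Γ₁ Γ₂ => Finsupp.single_apply
  rw [tensorCoeff, LinearMap.comp_apply, TensorProduct.map_tmul, h, h, LinearMap.mul'_apply,
    ite_and, ite_mul, one_mul, zero_mul]

open Classical in
theorem tensorCoeff_coproductOn (P : Set G2) (Θ Γ' Γ : G2) :
    tensorCoeff Θ Γ' (coproductOn P (MonoidAlgebra.single Γ (1 : ℚ))) =
      if Θ ∈ P then (Nat.card {K : TwoGraph Γ.rep.V Γ.rep.H Γ.rep.S //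
        Γ.rep.graph.ContractsTo K Γ' ∧ K.unlabel = Θ} : ℚ) else 0 := by
  have h₁ : tensorCoeff Θ Γ' (coproductOn P (MonoidAlgebra.single Γ (1 : ℚ))) =
      ∑ K : Γ.rep.graph.Subgraph, if K.1.unlabel = Θ ∧ Θ ∈ P ∧
        (Γ.rep.graph.contract K.1 K.2).unlabel = Γ' then (1 : ℚ) else 0 := by
    simp only [coproductOn, LinearMap.comp_apply]
    have : (MonoidAlgebra.coeffLinearEquiv ℚ).toLinearMap (MonoidAlgebra.single Γ (1 : ℚ)) =
      Finsupp.single Γ (1 : ℚ) := rfl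
    rw [this, Finsupp.linearCombination_single, one_smul, map_sum]
    refine Finset.sum_congr rfl fun K _ => ?_
    rw [apply_ite (tensorCoeff Θ Γ'), map_zero, tensorCoeff_single_tmul_single]
    by_cases h : K.1.unlabel = Θ
    · subst h
      by_cases h : K.1.unlabel ∈ P <;> simp [h]
    · simp [h]
  rw [h₁]
  by_cases hP : Θ ∈ P
  · simp only [hP, true_and, if_true, Finset.sum_boole]
    rw [← Fintype.card_subtype, ← Nat.card_eq_fintype_card]
    congr 1
    exact Nat.card_congr
      { toFun := fun K => ⟨K.1.1, ⟨K.1.2, K.2.2⟩, K.2.1⟩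
        invFun := fun K => ⟨⟨K.1, K.2.1.1⟩, K.2.2, K.2.1.2⟩
        left_inv := fun _ => rfl
        right_inv := fun _ => rfl }
  · simp [hP]

/-- The factor `Γ.autCard` will cancel the weight of Γ in the series, and what is left is a count on
the fixed label sets of `K`, which can be summed over all Γ. -/
theorem card_subgraph_eq {V H S : Type} [Finite V] [Finite H] [Finite S] (K : TwoGraph V H S)
    (Γ' Γ : G2) :
    (Nat.card {K' : TwoGraph Γ.rep.V Γ.rep.H Γ.rep.S //
        Γ.rep.graph.ContractsTo K' Γ' ∧ K'.unlabel = K.unlabel} : ℚ) =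
      Nat.card {G : TwoGraph V H S // G.ContractsTo K Γ' ∧ G.unlabel = Γ} * Γ.autCard /
        Nat.card (K.Iso K) := by
  have h := TwoGraph.card_contractsTo_mul Γ.rep.graph K Γ'
  rw [unlabel_rep, ← autCard_eq] at h
  have := K.card_iso_pos
  rw [eq_div_iff (by positivity)]
  exact_mod_cast h

/-- A subgraph has the same vertices, half-edges and strand sections as the whole, so every
contributing Γ is represented on the label sets of Θ, where only finitely many 2-graphs exist. -/
theorem finite_tensorCoeff_ne_zero (P : Set G2) (Θ Γ' : G2) :
    {Γ : G2 | tensorCoeff Θ Γ' (coproductOn P (MonoidAlgebra.single Γ (1 : ℚ))) ≠ 0}.Finite := by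
  classical
  refine (Set.finite_range fun G : TwoGraph Θ.rep.V Θ.rep.H Θ.rep.S => G.unlabel).subset ?_
  intro Γ hΓ
  rw [Set.mem_ofPred_eq, tensorCoeff_coproductOn] at hΓ
  have h : Nat.card {K : TwoGraph Γ.rep.V Γ.rep.H Γ.rep.S //
      Γ.rep.graph.ContractsTo K Γ' ∧ K.unlabel = Θ} ≠ 0 := by
    intro h0
    simp [h0] at hΓ
  rw [← unlabel_rep Θ, ← Nat.cast_ne_zero (R := ℚ), card_subgraph_eq] at h
  have h' : Nat.card {G : TwoGraph Θ.rep.V Θ.rep.H Θ.rep.S //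
      G.ContractsTo Θ.rep.graph Γ' ∧ G.unlabel = Γ} ≠ 0 := by
    intro h0
    simp [h0] at h
  obtain ⟨⟨G, -, hG⟩⟩ := (Nat.card_ne_zero.1 h').1
  exact ⟨G, hG⟩

/-- Summation over the values of a function on a finite type. -/
theorem finsum_card_fiber {X : Type} {Y : Type 1} [Finite X] (f : X → Y) (p : X → Prop)
    (c : Y → ℚ) :
    ∑ᶠ y, c y * (Nat.card {x // p x ∧ f x = y} : ℚ) = ∑ᶠ x : {x // p x}, c (f x.1) := by
  classical
  have := Fintype.ofFinite X
  rw [finsum_eq_sum_of_fintype (fun x : {x // p x} => c (f x.1)),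
    finsum_eq_sum_of_support_subset (s := Finset.univ.image f)]
  · have h₁ : ∀ y, c y * (Nat.card {x // p x ∧ f x = y} : ℚ) =
        ∑ x : {x // p x}, if f x.1 = y then c (f x.1) else 0 := by
      intro y
      rw [← Finset.sum_filter, Finset.sum_congr rfl (g := fun _ => c y)
        fun x hx => by rw [(Finset.mem_filter.1 hx).2], Finset.sum_const, nsmul_eq_mul, mul_comm,
        ← Fintype.card_subtype, ← Nat.card_eq_fintype_card]
      congr 2
      exact Nat.card_congr (Equiv.subtypeSubtypeEquivSubtypeInter p (fun x => f x = y)).symm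
    simp_rw [h₁]
    rw [Finset.sum_comm]
    refine Finset.sum_congr rfl fun x _ => ?_
    rw [Finset.sum_ite_eq]
    simp
  · intro y hy
    rw [Function.mem_support] at hy
    have : Nat.card {x // p x ∧ f x = y} ≠ 0 := fun h0 => hy (by rw [h0, Nat.cast_zero, mul_zero])
    obtain ⟨⟨x, -, rfl⟩⟩ := (Nat.card_ne_zero.1 this).1
    simp

open Classical in
/-- The coefficients of the coproduct of a weighted series. -/
theorem applySeries_coproductOn (P A : Set G2) {V H S : Type} [Finite V] [Finite H] [Finite S]
    (K : TwoGraph V H S) (Γ' : G2) :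
    applySeries (coproductOn P) (weighted A) K.unlabel Γ' =
      if K.unlabel ∈ P then
        (Nat.card {G : TwoGraph V H S // G.ContractsTo K Γ' ∧ G.unlabel ∈ A} : ℚ) /
          Nat.card (K.Iso K) else 0 := by
  simp only [applySeries, tensorCoeff_coproductOn]
  split_ifs
  swap
  · simp
  simp_rw [card_subgraph_eq]
  have h₁ : ∀ Γ : G2, weighted A Γ *
      (Nat.card {G : TwoGraph V H S // G.ContractsTo K Γ' ∧ G.unlabel = Γ} * Γ.autCard /
        Nat.card (K.Iso K)) = (if Γ ∈ A then 1 / (Nat.card (K.Iso K) : ℚ) else 0) *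
      Nat.card {G : TwoGraph V H S // G.ContractsTo K Γ' ∧ G.unlabel = Γ} := by
    intro Γ
    have := Γ.autCard_pos
    unfold weighted
    split_ifs
    · field_simp
    · simp
  simp_rw [h₁]
  -- Summing over classes the number of labelled `G` in each class gives one sum over all labelled
  -- `G`, every one with the same weight.
  rw [finsum_card_fiber]
  have := Fintype.ofFinite {G : TwoGraph V H S // G.ContractsTo K Γ'}
  rw [finsum_eq_sum_of_fintype, ← Finset.sum_filter, Finset.sum_const, nsmul_eq_mul,
    ← Fintype.card_subtype, ← Nat.card_eq_fintype_card, mul_one_div]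
  congr 2
  exact Nat.card_congr (Equiv.subtypeSubtypeEquivSubtypeInter
    (fun G : TwoGraph V H S => G.ContractsTo K Γ') (fun G => G.unlabel ∈ A))

end G2

/-! ### Gluing bijections along fibers -/

/-- The map with given restrictions to the fibers of `p`. -/
def fiberGlueFun {A A' I I' : Type} {p : A → I} {q : A' → I'} {f : I ≃ I'}
    (g : ∀ i, {a // p a = i} ≃ {a' // q a' = f i}) (a : A) : A' :=
  (g (p a) ⟨a, rfl⟩).1

section FiberGlue

variable {A A' I I' : Type} {p : A → I} {q : A' → I'} {f : I ≃ I'}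

/-- The definition evaluates `g` at the index `p a` itself; allowing any index equal to it absorbs
the casts between fibers in all later uses. -/
theorem fiberGlueFun_eq (g : ∀ i, {a // p a = i} ≃ {a' // q a' = f i}) {i : I} {a : A}
    (h : p a = i) : fiberGlueFun g a = (g i ⟨a, h⟩).1 := by
  subst h
  rfl

theorem fiberGlueFun_bijective (g : ∀ i, {a // p a = i} ≃ {a' // q a' = f i}) :
    Function.Bijective (fiberGlueFun g) := by
  constructor
  · intro a b h
    have ha := (g (p a) ⟨a, rfl⟩).2
    have hb := (g (p b) ⟨b, rfl⟩).2
    have hp : p b = p a := f.injective (by rw [← ha, ← hb]; exact congrArg q h.symm)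
    rw [fiberGlueFun_eq g hp] at h
    exact congrArg Subtype.val ((g (p a)).injective (Subtype.ext h))
  · intro a'
    obtain ⟨i, hi⟩ := f.surjective (q a')
    obtain ⟨⟨a, ha⟩, h⟩ := (g i).surjective ⟨a', hi.symm⟩
    exact ⟨a, by rw [fiberGlueFun_eq g ha, h]⟩

/-- The bijection with given restrictions to the fibers of `p`. -/
noncomputable def fiberGlue (g : ∀ i, {a // p a = i} ≃ {a' // q a' = f i}) : A ≃ A' :=
  Equiv.ofBijective _ (fiberGlueFun_bijective g)

theorem fiberGlue_eq (g : ∀ i, {a // p a = i} ≃ {a' // q a' = f i}) {i : I} {a : A}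
    (h : p a = i) : fiberGlue g a = (g i ⟨a, h⟩).1 :=
  fiberGlueFun_eq g h

theorem fiberGlue_spec (g : ∀ i, {a // p a = i} ≃ {a' // q a' = f i}) (a : A) :
    q (fiberGlue g a) = f (p a) :=
  (g (p a) ⟨a, rfl⟩).2

/-- The restriction of a fibered bijection to a fiber. -/
def fiberRestrict (e : A ≃ A') (h : ∀ a, q (e a) = f (p a)) (i : I) :
    {a // p a = i} ≃ {a' // q a' = f i} :=
  e.subtypeEquiv fun a => by rw [h, f.apply_eq_iff_eq]

end FiberGlue

namespace TwoGraph

variable {V H S V' H' S' : Type}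

/-! ### Bijections that preserve the vertex graphs -/

/-- Two 2-graphs differ only in their edges and edge strands. -/
def SameStars (G G' : TwoGraph V H S) : Prop :=
  G.ν = G'.ν ∧ G.μ = G'.μ ∧ G.σ₁ = G'.σ₁

theorem sameStars_map_iff {G : TwoGraph V H S} {R : TwoGraph V' H' S'}
    {e : Relabeling V H S V' H' S'} :
    (G.map e).SameStars R ↔ (∀ h, R.ν (e.2.1 h) = e.1 (G.ν h)) ∧
      (∀ s, R.μ (e.2.2 s) = e.2.1 (G.μ s)) ∧ ∀ s, R.σ₁ (e.2.2 s) = e.2.2 (G.σ₁ s) := by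
  simp only [SameStars, funext_iff, map]
  refine and_congr ?_ (and_congr ?_ ?_)
  · exact ⟨fun h x => by simpa using (h (e.2.1 x)).symm,
      fun h x => by simpa using (h (e.2.1.symm x)).symm⟩
  · exact ⟨fun h x => by simpa using (h (e.2.2 x)).symm,
      fun h x => by simpa using (h (e.2.2.symm x)).symm⟩
  · exact ⟨fun h x => by simpa using (h (e.2.2 x)).symm,
      fun h x => by simpa using (h (e.2.2.symm x)).symm⟩

/-- A star preserving bijection over a given bijection of vertices is a family of isomorphisms
of vertex graphs. -/
noncomputable def sameStarsEquiv (G : TwoGraph V H S) (R : TwoGraph V' H' S') (f : V ≃ V') :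
    {e : (H ≃ H') × (S ≃ S') // (G.map (f, e)).SameStars R} ≃
      ∀ v, (G.vertexGraph v).Iso (R.vertexGraph (f v)) where
  toFun e v :=
    have h := sameStars_map_iff.1 e.2
    { toV := fiberRestrict e.1.1 h.1 v
      toH := fiberRestrict e.1.2 (fun s => by rw [h.2.1, h.1]) v
      map_ν := fun s => Subtype.ext (h.2.1 s)
      map_ι := fun s => Subtype.ext (h.2.2 s) }
  invFun g := ⟨(fiberGlue fun v => (g v).toV, fiberGlue fun v => (g v).toH), by
    refine sameStars_map_iff.2 ⟨fiberGlue_spec _, fun s => ?_, fun s => ?_⟩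
    · exact (congrArg Subtype.val ((g _).map_ν ⟨s, rfl⟩)).trans
        (fiberGlue_eq (fun v => (g v).toV) rfl).symm
    -- The section `G.σ₁ s` lies at the same vertex as `s`, so the glued map is given there by the
    -- same member of the family `g`.
    · exact (congrArg Subtype.val ((g _).map_ι ⟨s, rfl⟩)).trans
        (fiberGlue_eq (fun v => (g v).toH) (G.ν_μ_σ₁ s)).symm⟩
  left_inv e := Subtype.ext (Prod.ext (Equiv.ext fun _ => rfl) (Equiv.ext fun _ => rfl))
  right_inv g := funext fun v => OneGraph.Iso.ext
    (fun h => Subtype.ext (fiberGlue_eq (fun v => (g v).toV) h.2))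
    (fun s => Subtype.ext (fiberGlue_eq (fun v => (g v).toH) s.2))

open Classical in
-- Half-edges and strand sections are partitioned by the vertices, and ν, μ, σ₁ do not mix different
-- vertices. Over a fixed bijection of vertices the choices at the vertices are therefore
-- independent.
theorem card_sameStars [Fintype V] [Finite H] [Finite S] [Fintype V'] [Finite H'] [Finite S']
    (G : TwoGraph V H S) (R : TwoGraph V' H' S') :
    Nat.card {e : Relabeling V H S V' H' S' // (G.map e).SameStars R} =
      ∑ f : V ≃ V', ∏ v, Nat.card ((G.vertexGraph v).Iso (R.vertexGraph (f v))) := by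
  have h : {e : Relabeling V H S V' H' S' // (G.map e).SameStars R} ≃
      Σ f : V ≃ V', {e : (H ≃ H') × (S ≃ S') // (G.map (f, e)).SameStars R} :=
    { toFun := fun e => ⟨e.1.1, e.1.2, e.2⟩
      invFun := fun e => ⟨(e.1, e.2.1), e.2.2⟩
      left_inv := fun _ => rfl
      right_inv := fun _ => rfl }
  rw [Nat.card_congr (h.trans (Equiv.sigmaCongrRight fun f => sameStarsEquiv G R f)),
    Nat.card_sigma]
  exact Finset.sum_congr rfl fun f _ => Nat.card_pi

/-! ### Insertion as the inverse of contraction -/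

open Classical in
/-- The 2-graph obtained by adding to `K` the edges and edge strands of a 2-graph `R` that has
the same stars as the residue of `K`. -/
noncomputable def insertion [Finite S] (K : TwoGraph V H S)
    (R : TwoGraph K.Component K.ExtH K.ExtS) (hR : R.SameStars K.residue) : TwoGraph V H S where
  ν := K.ν
  ι h := if hh : K.ι h = h then (R.ι ⟨h, hh⟩).1 else K.ι h
  ι_ι h := by
    by_cases hh : K.ι h = h
    · simp [hh, (R.ι ⟨h, hh⟩).2, R.ι_ι]
    · have : K.ι (K.ι h) ≠ K.ι h := by rw [K.ι_ι]; exact Ne.symm hh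
      rw [dif_neg hh, dif_neg this, K.ι_ι]
  μ := K.μ
  σ₁ := K.σ₁
  σ₁_σ₁ := K.σ₁_σ₁
  σ₁_ne := K.σ₁_ne
  ν_μ_σ₁ := K.ν_μ_σ₁
  σ₂ s := if hs : K.σ₂ s = s then (R.σ₂ ⟨s, hs⟩).1 else K.σ₂ s
  σ₂_σ₂ s := by
    by_cases hs : K.σ₂ s = s
    · simp [hs, (R.σ₂ ⟨s, hs⟩).2, R.σ₂_σ₂]
    · have : K.σ₂ (K.σ₂ s) ≠ K.σ₂ s := by rw [K.σ₂_σ₂]; exact Ne.symm hs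
      rw [dif_neg hs, dif_neg this, K.σ₂_σ₂]
  μ_σ₂ s := by
    by_cases hs : K.σ₂ s = s
    · rw [dif_pos hs, dif_pos ((K.σ₂_eq_iff s).1 hs)]
      have hμ : ∀ s : K.ExtS, K.μ s.1 = (R.μ s).1 := fun s => by rw [hR.2.1]; rfl
      rw [hμ, R.μ_σ₂]
      exact congrArg (fun h => (R.ι h).1) (Subtype.ext (hμ _).symm)
    · rw [dif_neg hs, dif_neg (mt (K.σ₂_eq_iff s).2 hs), K.μ_σ₂]
  σ₂_eq_iff s := by
    by_cases hs : K.σ₂ s = s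
    · rw [dif_pos hs, dif_pos ((K.σ₂_eq_iff s).1 hs)]
      have h := R.σ₂_eq_iff ⟨s, hs⟩
      have hμ : R.μ ⟨s, hs⟩ = ⟨K.μ s, (K.σ₂_eq_iff s).1 hs⟩ := by rw [hR.2.1]; rfl
      rw [hμ, Subtype.ext_iff, Subtype.ext_iff] at h
      exact h
    · rw [dif_neg hs, dif_neg (mt (K.σ₂_eq_iff s).2 hs), K.σ₂_eq_iff]

section Insertion

variable [Finite S] {K : TwoGraph V H S} {R : TwoGraph K.Component K.ExtH K.ExtS}

theorem isSubgraph_insertion (hR : R.SameStars K.residue) : K.IsSubgraph (K.insertion R hR) where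
  ν_eq := rfl
  μ_eq := rfl
  σ₁_eq := rfl
  ι_eq h hh := by simp [insertion, hh]
  σ₂_eq s hs := by simp [insertion, hs]

/-- The maps ν, μ, σ₁ of a contraction by `K` depend on `K` only and are those of the residue. The
remaining data are ι and σ₂ on external elements, which insertion copies and contraction reads off
again. -/
theorem contract_insertion (hR : R.SameStars K.residue) :
    (K.insertion R hR).contract K (isSubgraph_insertion hR) = R := by
  obtain ⟨h₁, h₂, h₃⟩ := hR
  refine TwoGraph.ext h₁.symm (funext fun h => Subtype.ext ?_) h₂.symm h₃.symm
    (funext fun s => Subtype.ext ?_)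
  · simp [insertion, contract, h.2]
  · simp [insertion, contract, s.2]

theorem insertion_contract {G : TwoGraph V H S} (hK : K.IsSubgraph G) :
    K.insertion (G.contract K hK) ⟨rfl, rfl, rfl⟩ = G := by
  refine TwoGraph.ext hK.ν_eq (funext fun h => ?_) hK.μ_eq hK.σ₁_eq (funext fun s => ?_)
  · by_cases hh : K.ι h = h
    · simp [insertion, contract, hh]
    · simpa [insertion, hh] using hK.ι_eq h hh
  · by_cases hs : K.σ₂ s = s
    · simp [insertion, contract, hs]
    · simpa [insertion, hs] using hK.σ₂_eq s hs

/-- The 2-graphs that contain `K` correspond to the 2-graphs with the stars of its residue. -/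
noncomputable def contractEquiv [Finite V] [Finite H] (K : TwoGraph V H S) (Γ : G2) :
    {G : TwoGraph V H S // G.ContractsTo K Γ} ≃
      {R : TwoGraph K.Component K.ExtH K.ExtS // R.SameStars K.residue ∧ R.unlabel = Γ} where
  toFun G := ⟨G.1.contract K G.2.1, ⟨rfl, rfl, rfl⟩, G.2.2⟩
  invFun R := ⟨K.insertion R.1 R.2.1, isSubgraph_insertion R.2.1, by
    rw [contract_insertion]
    exact R.2.2⟩
  left_inv G := Subtype.ext (insertion_contract G.2.1)
  right_inv R := Subtype.ext (contract_insertion R.2.1)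

end Insertion

/-- The number of insertions of `K` that contract to `Γ`, in terms of vertex graphs. -/
theorem card_contractsTo_mul_autCard [Finite V] [Finite H] [Finite S] (K : TwoGraph V H S)
    (Γ : G2) :
    Nat.card {G : TwoGraph V H S // G.ContractsTo K Γ} * Γ.autCard =
      Nat.card {e : Relabeling Γ.rep.V Γ.rep.H Γ.rep.S K.Component K.ExtH K.ExtS //
        (Γ.rep.graph.map e).SameStars K.residue} := by
  have h := card_map_mem Γ.rep.graph {R | R.SameStars K.residue}
  simp only [Set.mem_ofPred_eq] at h
  rw [h, Nat.card_congr (contractEquiv K Γ), G2.autCard_eq]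
  congr 1
  refine Nat.card_congr (Equiv.subtypeEquivRight fun R => and_congr_right fun _ => ?_)
  rw [← unlabel_eq_iff, G2.unlabel_rep, eq_comm]

end TwoGraph

open Classical in
-- The isomorphisms form a torsor under the automorphisms or are absent. Read backwards, this turns
-- |Aut γ_v| times the condition "the boundary is γ_v" into a number of isomorphisms.
theorem OneGraph.card_iso {V H V' H' : Type} [Finite V] [Finite H] [Finite V'] [Finite H']
    (g : OneGraph V H) (g' : OneGraph V' H') :
    Nat.card (g.Iso g') = if g.unlabel = g'.unlabel then g.unlabel.autCard else 0 := by
  split_ifs with h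
  · obtain ⟨i⟩ := unlabel_eq_iff.1 h
    exact Nat.card_congr (OneGraph.Iso.transEquiv g i).symm
  · have : IsEmpty (g.Iso g') := not_nonempty_iff.1 (mt unlabel_eq_iff.2 h)
    exact Nat.card_of_isEmpty

namespace TwoGraph

variable {V H S V' H' S' I I' : Type}

open Classical in
theorem card_iso [Finite V] [Finite H] [Finite S] [Finite V'] [Finite H'] [Finite S']
    (G : TwoGraph V H S) (G' : TwoGraph V' H' S') :
    Nat.card (G.Iso G') = if G.unlabel = G'.unlabel then G.unlabel.autCard else 0 := by
  split_ifs with h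
  · obtain ⟨i⟩ := unlabel_eq_iff.1 h
    exact Nat.card_congr (TwoGraph.Iso.transEquiv G i).symm
  · have : IsEmpty (G.Iso G') := not_nonempty_iff.1 (mt unlabel_eq_iff.2 h)
    exact Nat.card_of_isEmpty

/-! ### Restriction to unions of connected components -/

/-- The restriction of a 2-graph to a set of vertices that is closed under edges. -/
def restrict (G : TwoGraph V H S) (Q : V → Prop) (hQ : ∀ h, Q (G.ν h) → Q (G.ν (G.ι h))) :
    TwoGraph {v // Q v} {h // Q (G.ν h)} {s // Q (G.ν (G.μ s))} where
  ν h := ⟨G.ν h, h.2⟩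
  ι h := ⟨G.ι h, hQ h h.2⟩
  ι_ι h := Subtype.ext (G.ι_ι h)
  μ s := ⟨G.μ s, s.2⟩
  σ₁ s := ⟨G.σ₁ s, by rw [G.ν_μ_σ₁]; exact s.2⟩
  σ₁_σ₁ s := Subtype.ext (G.σ₁_σ₁ s)
  σ₁_ne s h := G.σ₁_ne s (congrArg Subtype.val h)
  ν_μ_σ₁ s := Subtype.ext (G.ν_μ_σ₁ s)
  σ₂ s := ⟨G.σ₂ s, by rw [G.μ_σ₂]; exact hQ _ s.2⟩
  σ₂_σ₂ s := Subtype.ext (G.σ₂_σ₂ s)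
  μ_σ₂ s := Subtype.ext (G.μ_σ₂ s)
  σ₂_eq_iff s := by
    rw [Subtype.ext_iff, Subtype.ext_iff]
    exact G.σ₂_eq_iff s

/-- The restriction to all vertices. -/
def restrictIso (G : TwoGraph V H S) (Q : V → Prop) (hQ : ∀ h, Q (G.ν h) → Q (G.ν (G.ι h)))
    (h : ∀ v, Q v) : (G.restrict Q hQ).Iso G where
  toV := Equiv.subtypeUnivEquiv h
  toH := Equiv.subtypeUnivEquiv fun _ => h _
  toS := Equiv.subtypeUnivEquiv fun _ => h _
  map_ν _ := rfl
  map_ι _ := rfl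
  map_μ _ := rfl
  map_σ₁ _ := rfl
  map_σ₂ _ := rfl

/-- The restriction to the empty set. -/
def restrictEmptyIso (G : TwoGraph V H S) (Q : V → Prop)
    (hQ : ∀ h, Q (G.ν h) → Q (G.ν (G.ι h))) (h : ∀ v, ¬ Q v) :
    (G.restrict Q hQ).Iso emptyGraph where
  toV := @Equiv.equivOfIsEmpty _ _ (Subtype.isEmpty_of_false h) _
  toH := @Equiv.equivOfIsEmpty _ _ (Subtype.isEmpty_of_false fun _ => h _) _
  toS := @Equiv.equivOfIsEmpty _ _ (Subtype.isEmpty_of_false fun _ => h _) _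
  map_ν x := (h _ x.2).elim
  map_ι x := (h _ x.2).elim
  map_μ x := (h _ x.2).elim
  map_σ₁ x := (h _ x.2).elim
  map_σ₂ x := (h _ x.2).elim

/-- The subtype of a disjoint union of predicates. -/
noncomputable def sumSubtypeEquiv {A : Type} {Q R T : A → Prop} (hT : ∀ a, T a ↔ Q a ∨ R a)
    (hd : ∀ a, Q a → ¬ R a) : {a // Q a} ⊕ {a // R a} ≃ {a // T a} :=
  Equiv.ofBijective
    (Sum.elim (fun a => ⟨a.1, (hT _).2 (Or.inl a.2)⟩) fun a => ⟨a.1, (hT _).2 (Or.inr a.2)⟩) <| by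
    constructor
    · rintro (⟨a, ha⟩ | ⟨a, ha⟩) (⟨b, hb⟩ | ⟨b, hb⟩) h <;>
        obtain rfl := congrArg (Subtype.val (p := T)) h
      · rfl
      · exact (hd _ ha hb).elim
      · exact (hd _ hb ha).elim
      · rfl
    · rintro ⟨a, ha⟩
      rcases (hT a).1 ha with h | h
      · exact ⟨Sum.inl ⟨a, h⟩, rfl⟩
      · exact ⟨Sum.inr ⟨a, h⟩, rfl⟩

/-- The restriction to a disjoint union is a disjoint union. -/
noncomputable def disjUnionRestrictIso (G : TwoGraph V H S) {Q R T : V → Prop}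
    (hQ : ∀ h, Q (G.ν h) → Q (G.ν (G.ι h))) (hR : ∀ h, R (G.ν h) → R (G.ν (G.ι h)))
    (hT' : ∀ h, T (G.ν h) → T (G.ν (G.ι h))) (hT : ∀ a, T a ↔ Q a ∨ R a)
    (hd : ∀ a, Q a → ¬ R a) :
    ((G.restrict Q hQ).disjUnion (G.restrict R hR)).Iso (G.restrict T hT') where
  toV := sumSubtypeEquiv hT hd
  toH := sumSubtypeEquiv (fun _ => hT _) fun _ => hd _
  toS := sumSubtypeEquiv (fun _ => hT _) fun _ => hd _
  map_ν := by rintro (x | x) <;> rfl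
  map_ι := by rintro (x | x) <;> rfl
  map_μ := by rintro (x | x) <;> rfl
  map_σ₁ := by rintro (x | x) <;> rfl
  map_σ₂ := by rintro (x | x) <;> rfl

/-- A walk cannot leave a set closed under edges. The two claims are proved together because the
transitive case needs the intermediate vertex to lie in `Q`. -/
theorem restrict_joined (G : TwoGraph V H S) (Q : V → Prop)
    (hQ : ∀ h, Q (G.ν h) → Q (G.ν (G.ι h))) {v w : V} (h : G.joined v w) :
    (Q v ↔ Q w) ∧ ∀ (hv : Q v) (hw : Q w), (G.restrict Q hQ).joined ⟨v, hv⟩ ⟨w, hw⟩ := by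
  induction h with
  | rel _ _ h =>
    obtain ⟨k, rfl, rfl⟩ := h
    exact ⟨⟨hQ k, fun h => by simpa [G.ι_ι] using hQ _ h⟩,
      fun hv _ => (G.restrict Q hQ).joined_edge ⟨k, hv⟩⟩
  | refl _ => exact ⟨Iff.rfl, fun hv _ => (G.restrict Q hQ).joined.refl _⟩
  | symm _ _ _ ih => exact ⟨ih.1.symm, fun hv hw => (G.restrict Q hQ).joined.symm (ih.2 hw hv)⟩
  | trans _ _ _ _ _ ih₁ ih₂ =>
    exact ⟨ih₁.1.trans ih₂.1, fun hv hw => (G.restrict Q hQ).joined.trans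
      (ih₁.2 hv (ih₁.1.1 hv)) (ih₂.2 _ hw)⟩

/-! ### Decompositions into parts -/

/-- The part of `G` over `i`, for a map `p` that is constant along edges. -/
def part (G : TwoGraph V H S) (p : V → I) (hp : ∀ h, p (G.ν (G.ι h)) = p (G.ν h)) (i : I) :
    TwoGraph {v // p v = i} {h // p (G.ν h) = i} {s // p (G.ν (G.μ s)) = i} :=
  G.restrict (fun v => p v = i) fun h hi => (hp h).trans hi

/-- A 2-graph is the disjoint union of its parts. -/
theorem prod_unlabel_part [Finite V] [Finite H] [Finite S] [Fintype I] (G : TwoGraph V H S)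
    (p : V → I) (hp : ∀ h, p (G.ν (G.ι h)) = p (G.ν h)) :
    ∏ i, (G.part p hp i).unlabel = G.unlabel := by
  classical
  -- For the induction the claim is generalised from all of `I` to the union of the parts over a
  -- finite set of indices.
  have key : ∀ s : Finset I, ∏ i ∈ s, (G.part p hp i).unlabel =
      (G.restrict (fun v => p v ∈ s) fun h hi => by rwa [hp]).unlabel := by
    intro s
    induction s using Finset.induction_on with
    | empty =>
      rw [Finset.prod_empty, G2.one_eq_unlabel]
      exact ((G.restrictEmptyIso _ _ fun v => Finset.notMem_empty _).unlabel_eq).symm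
    | insert a s ha ih =>
      rw [Finset.prod_insert ha, ih, unlabel_mul_unlabel]
      exact (G.disjUnionRestrictIso (Q := fun v => p v = a) (R := fun v => p v ∈ s) _ _ _
        (fun v => Finset.mem_insert) fun v hv h => ha (hv ▸ h)).unlabel_eq
  rw [key]
  exact (G.restrictIso _ _ fun v => Finset.mem_univ _).unlabel_eq

/-- Isomorphisms over a given bijection of the index sets are families of isomorphisms of the
parts. -/
noncomputable def isoOverEquiv (G : TwoGraph V H S) (G' : TwoGraph V' H' S') (p : V → I)
    (hp : ∀ h, p (G.ν (G.ι h)) = p (G.ν h)) (p' : V' → I')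
    (hp' : ∀ h, p' (G'.ν (G'.ι h)) = p' (G'.ν h)) (f : I ≃ I') :
    {e : G.Iso G' // ∀ v, p' (e.toV v) = f (p v)} ≃
      ∀ i, (G.part p hp i).Iso (G'.part p' hp' (f i)) where
  toFun e i :=
    { toV := fiberRestrict e.1.toV e.2 i
      toH := fiberRestrict e.1.toH (fun h => by rw [e.1.map_ν, e.2]) i
      toS := fiberRestrict e.1.toS (fun s => by rw [e.1.map_μ, e.1.map_ν, e.2]) i
      map_ν := fun h => Subtype.ext (e.1.map_ν h)
      map_ι := fun h => Subtype.ext (e.1.map_ι h)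
      map_μ := fun s => Subtype.ext (e.1.map_μ s)
      map_σ₁ := fun s => Subtype.ext (e.1.map_σ₁ s)
      map_σ₂ := fun s => Subtype.ext (e.1.map_σ₂ s) }
  invFun g := ⟨
    { toV := fiberGlue fun i => (g i).toV
      toH := fiberGlue fun i => (g i).toH
      toS := fiberGlue fun i => (g i).toS
      map_ν := fun h => (congrArg Subtype.val ((g _).map_ν ⟨h, rfl⟩)).trans
        (fiberGlue_eq (fun i => (g i).toV) rfl).symm
      map_ι := fun h => (congrArg Subtype.val ((g _).map_ι ⟨h, rfl⟩)).trans
        (fiberGlue_eq (fun i => (g i).toH) (hp h)).symm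
      map_μ := fun s => (congrArg Subtype.val ((g _).map_μ ⟨s, rfl⟩)).trans
        (fiberGlue_eq (fun i => (g i).toH) rfl).symm
      map_σ₁ := fun s => (congrArg Subtype.val ((g _).map_σ₁ ⟨s, rfl⟩)).trans
        (fiberGlue_eq (fun i => (g i).toS) (congrArg p (G.ν_μ_σ₁ s))).symm
      map_σ₂ := fun s => (congrArg Subtype.val ((g _).map_σ₂ ⟨s, rfl⟩)).trans
        (fiberGlue_eq (fun i => (g i).toS) ((congrArg (fun h => p (G.ν h)) (G.μ_σ₂ s)).trans
          (hp _))).symm },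
    fiberGlue_spec _⟩
  left_inv e := Subtype.ext (TwoGraph.Iso.ext (fun _ => rfl) (fun _ => rfl) fun _ => rfl)
  right_inv g := funext fun i => TwoGraph.Iso.ext
    (fun v => Subtype.ext (fiberGlue_eq (fun i => (g i).toV) v.2))
    (fun h => Subtype.ext (fiberGlue_eq (fun i => (g i).toH) h.2))
    (fun s => Subtype.ext (fiberGlue_eq (fun i => (g i).toS) s.2))

/-- The fibers of `p` are the connected components of `G`. -/
structure IsComponentMap (G : TwoGraph V H S) (p : V → I) : Prop where
  surj : Function.Surjective p
  eq_iff : ∀ {v w}, p v = p w ↔ G.joined v w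

theorem IsComponentMap.edge {G : TwoGraph V H S} {p : V → I} (hp : G.IsComponentMap p) (h : H) :
    p (G.ν (G.ι h)) = p (G.ν h) :=
  (hp.eq_iff.2 (G.joined_edge h)).symm

theorem IsComponentMap.isConnected_part {G : TwoGraph V H S} {p : V → I}
    (hp : G.IsComponentMap p) (i : I) : (G.part p hp.edge i).IsConnected := by
  obtain ⟨v, hv⟩ := hp.surj i
  exact ⟨⟨⟨v, hv⟩⟩, fun a b => (G.restrict_joined _ _ (hp.eq_iff.1 (a.2.trans b.2.symm))).2 _ _⟩

/-- The connected component of a vertex. -/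
def toComponent (G : TwoGraph V H S) (v : V) : G.Component := Quotient.mk G.joined v

theorem isComponentMap_toComponent (G : TwoGraph V H S) : G.IsComponentMap G.toComponent where
  surj := Quotient.mk_surjective
  eq_iff := Quotient.eq

/-- An isomorphism induces a bijection of the sets of components. -/
theorem IsComponentMap.exists_equiv {G : TwoGraph V H S} {G' : TwoGraph V' H' S'} {p : V → I}
    {p' : V' → I'} (hp : G.IsComponentMap p) (hp' : G'.IsComponentMap p') (e : G.Iso G') :
    ∃ f : I ≃ I', ∀ v, p' (e.toV v) = f (p v) := by
  let q : I → I' := fun i => p' (e.toV (Function.surjInv hp.surj i))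
  have hq : ∀ v, p' (e.toV v) = q (p v) := fun v =>
    hp'.eq_iff.2 (e.joined (hp.eq_iff.1 (Function.surjInv_eq hp.surj (p v)).symm))
  have hbij : Function.Bijective q := by
    constructor
    · intro i j hij
      obtain ⟨v, rfl⟩ := hp.surj i
      obtain ⟨w, rfl⟩ := hp.surj j
      rw [← hq, ← hq] at hij
      exact hp.eq_iff.2 (e.joined_iff.1 (hp'.eq_iff.1 hij))
    · intro i'
      obtain ⟨v', rfl⟩ := hp'.surj i'
      exact ⟨p (e.toV.symm v'), by rw [← hq, Equiv.apply_symm_apply]⟩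
  exact ⟨Equiv.ofBijective q hbij, hq⟩

open Classical in
/-- Isomorphisms permute the components. -/
theorem card_iso_eq_sum [Finite V] [Finite H] [Finite S] [Finite V'] [Finite H'] [Finite S']
    [Fintype I] [Fintype I'] {G : TwoGraph V H S} {G' : TwoGraph V' H' S'} {p : V → I}
    {p' : V' → I'} (hp : G.IsComponentMap p) (hp' : G'.IsComponentMap p') :
    Nat.card (G.Iso G') = ∑ f : I ≃ I', ∏ i,
      Nat.card ((G.part p hp.edge i).Iso (G'.part p' hp'.edge (f i))) := by
  choose F hF using fun e : G.Iso G' => hp.exists_equiv hp' e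
  -- Since `p` is onto, at most one bijection of index sets lies under `e`; so the fiber of the
  -- choice `F` over `f` consists of all isomorphisms that lie over `f`.
  have h : ∀ f, {e : G.Iso G' // F e = f} ≃ {e : G.Iso G' // ∀ v, p' (e.toV v) = f (p v)} := by
    refine fun f => Equiv.subtypeEquivRight fun e => ⟨?_, fun h => Equiv.ext fun i => ?_⟩
    · rintro rfl
      exact hF e
    · obtain ⟨v, rfl⟩ := hp.surj i
      rw [← h, hF]
  rw [Nat.card_congr ((Equiv.sigmaFiberEquiv F).symm.trans (Equiv.sigmaCongrRight fun f =>
    (h f).trans (isoOverEquiv G G' p hp.edge p' hp'.edge f))), Nat.card_sigma]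
  exact Finset.sum_congr rfl fun f _ => Nat.card_pi

/-! ### Disjoint unions of families -/

section Sigma

variable {VI HI SI : I → Type}

/-- The disjoint union of a family of 2-graphs. -/
def sigma (G : ∀ i, TwoGraph (VI i) (HI i) (SI i)) :
    TwoGraph (Σ i, VI i) (Σ i, HI i) (Σ i, SI i) where
  ν := Sigma.map id fun i => (G i).ν
  ι := Sigma.map id fun i => (G i).ι
  ι_ι := by rintro ⟨i, h⟩; simp [Sigma.map, OneGraph.ι_ι]
  μ := Sigma.map id fun i => (G i).μ
  σ₁ := Sigma.map id fun i => (G i).σ₁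
  σ₁_σ₁ := by rintro ⟨i, s⟩; simp [Sigma.map, σ₁_σ₁]
  σ₁_ne := by rintro ⟨i, s⟩; simp [Sigma.map, σ₁_ne]
  ν_μ_σ₁ := by rintro ⟨i, s⟩; simp [Sigma.map, ν_μ_σ₁]
  σ₂ := Sigma.map id fun i => (G i).σ₂
  σ₂_σ₂ := by rintro ⟨i, s⟩; simp [Sigma.map, σ₂_σ₂]
  μ_σ₂ := by rintro ⟨i, s⟩; simp [Sigma.map, μ_σ₂]
  σ₂_eq_iff := by rintro ⟨i, s⟩; simp [Sigma.map, σ₂_eq_iff]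

theorem sigma_edge (G : ∀ i, TwoGraph (VI i) (HI i) (SI i)) (h : Σ i, HI i) :
    ((sigma G).ν ((sigma G).ι h)).1 = ((sigma G).ν h).1 := rfl

/-- The parts of a disjoint union. -/
def sigmaPartIso (G : ∀ i, TwoGraph (VI i) (HI i) (SI i)) (i : I) :
    (G i).Iso ((sigma G).part Sigma.fst (sigma_edge G) i) where
  toV := (Equiv.sigmaSubtype i).symm
  toH := (Equiv.sigmaSubtype i).symm
  toS := (Equiv.sigmaSubtype i).symm
  map_ν _ := rfl
  map_ι _ := rfl
  map_μ _ := rfl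
  map_σ₁ _ := rfl
  map_σ₂ _ := rfl

/-- For connected summands the index set itself serves as the set of components, so
`card_iso_eq_sum` can match indices with the components of another graph directly. -/
theorem isComponentMap_sigma {G : ∀ i, TwoGraph (VI i) (HI i) (SI i)}
    (hG : ∀ i, (G i).IsConnected) :
    (sigma G).IsComponentMap (Sigma.fst : (Σ i, VI i) → I) where
  surj i := ⟨⟨i, (hG i).1.some⟩, rfl⟩
  eq_iff := by
    rintro ⟨i, v⟩ ⟨j, w⟩
    constructor
    · rintro rfl
      exact OneGraph.joined_lift ((hG i).2 v w) (sigma G).joined (Sigma.mk i)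
        fun h => (sigma G).joined_edge ⟨i, h⟩
    · intro h
      exact OneGraph.joined_lift h (⊥ : Setoid I) Sigma.fst fun h => rfl

theorem unlabel_sigma [Fintype I] [∀ i, Finite (VI i)] [∀ i, Finite (HI i)] [∀ i, Finite (SI i)]
    (G : ∀ i, TwoGraph (VI i) (HI i) (SI i)) : (sigma G).unlabel = ∏ i, (G i).unlabel := by
  rw [← prod_unlabel_part (sigma G) Sigma.fst (sigma_edge G)]
  exact Finset.prod_congr rfl fun i _ => (sigmaPartIso G i).unlabel_eq.symm

end Sigma

/-! ### Components and their boundaries -/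

/-- A connected component as a 2-graph. -/
def componentGraph (G : TwoGraph V H S) (c : G.Component) :
    TwoGraph {v // G.toComponent v = c} {h // G.toComponent (G.ν h) = c}
      {s // G.toComponent (G.ν (G.μ s)) = c} :=
  G.part G.toComponent G.isComponentMap_toComponent.edge c

theorem isConnected_componentGraph (G : TwoGraph V H S) (c : G.Component) :
    (G.componentGraph c).IsConnected :=
  G.isComponentMap_toComponent.isConnected_part c

theorem prod_unlabel_componentGraph [Finite V] [Finite H] [Finite S] (G : TwoGraph V H S)
    [Fintype G.Component] : ∏ c, (G.componentGraph c).unlabel = G.unlabel :=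
  prod_unlabel_part G G.toComponent G.isComponentMap_toComponent.edge

/-- The vertex graphs of the residue are the boundaries of the components. -/
def componentBoundaryIso [Finite S] (G : TwoGraph V H S) (c : G.Component) :
    (G.componentGraph c).boundary.Iso (G.residue.vertexGraph c) where
  toV :=
    { toFun := fun h => ⟨⟨h.1.1, congrArg Subtype.val h.2⟩, h.1.2⟩
      invFun := fun h => ⟨⟨h.1.1, h.2⟩, Subtype.ext h.1.2⟩
      left_inv := fun _ => rfl
      right_inv := fun _ => rfl }
  toH :=
    { toFun := fun s => ⟨⟨s.1.1, congrArg Subtype.val s.2⟩, s.1.2⟩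
      invFun := fun s => ⟨⟨s.1.1, s.2⟩, Subtype.ext s.1.2⟩
      left_inv := fun _ => rfl
      right_inv := fun _ => rfl }
  map_ν _ := rfl
  -- Reachability inside a component is reachability in `G`, so the external faces of a component
  -- are external faces of `G`.
  map_ι s := Subtype.ext <| faceEnd_comm (G := G.componentGraph c)
    (fun s => (⟨s.1.1, congrArg Subtype.val s.2⟩ : G.ExtS))
    (fun _ _ h => Subtype.ext (Subtype.ext (congrArg (fun x : G.ExtS => x.1) h)))
    (fun _ _ h => h.lift Subtype.val (fun s => G.reach_σ₁ s.1) fun s => G.reach_σ₂ s.1) s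

end TwoGraph

/-! ### Boundary and connectedness do not depend on the representative -/

namespace TwoGraph

variable {V H S : Type} [Finite V] [Finite H] [Finite S]

theorem boundary_unlabel (G : TwoGraph V H S) : G.unlabel.boundary = G.boundary.unlabel := by
  obtain ⟨i⟩ := G2.exists_iso_rep G
  exact OneGraph.unlabel_eq_iff.2 ⟨i.boundary.symm⟩

theorem isConnected_rep_unlabel (G : TwoGraph V H S) :
    G.unlabel.rep.graph.IsConnected ↔ G.IsConnected := by
  obtain ⟨i⟩ := G2.exists_iso_rep G
  exact ⟨i.symm.isConnected, i.isConnected⟩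

theorem unlabel_mem_connectedWithBoundary (G : TwoGraph V H S) (γ : G1) :
    G.unlabel ∈ G2.connectedWithBoundary γ ↔ G.IsConnected ∧ G.boundary.unlabel = γ := by
  rw [← isConnected_rep_unlabel, ← boundary_unlabel]
  rfl

end TwoGraph

namespace G2

/-! ### Products of series over connected graphs -/

/-- Realises a factorization of the class of `K` as an actual decomposition of the labelled graph
`K`. -/
theorem exists_sigma_iso {I : Type} [Fintype I] (T : I → G2) {V H S : Type} [Finite V] [Finite H]
    [Finite S] {K : TwoGraph V H S} (h : ∏ i, T i = K.unlabel) :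
    Nonempty ((TwoGraph.sigma fun i => (T i).rep.graph).Iso K) := by
  rw [← TwoGraph.unlabel_eq_iff, TwoGraph.unlabel_sigma, ← h]
  exact Finset.prod_congr rfl fun i _ => unlabel_rep _

/-- Every factorization of Θ is read off from a map of the vertices of one representative to `I`
that is constant along edges, and there are finitely many such maps. -/
theorem finite_prod_eq (I : Type) [Fintype I] (Θ : G2) : {T : I → G2 | ∏ i, T i = Θ}.Finite := by
  let K := Θ.rep.graph
  refine (Set.finite_range fun (p : {p : Θ.rep.V → I // ∀ h, p (K.ν (K.ι h)) = p (K.ν h)}) i =>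
    (K.part p.1 p.2 i).unlabel).subset fun T hT => ?_
  obtain ⟨e⟩ := exists_sigma_iso T (K := K) (hT.trans (unlabel_rep Θ).symm)
  let p : Θ.rep.V → I := fun v => (e.toV.symm v).1
  have hp : ∀ h, p (K.ν (K.ι h)) = p (K.ν h) := by
    intro h
    have h₁ := e.symm.map_ν h
    have h₂ := e.symm.map_ν (K.ι h)
    rw [show e.symm.toH (K.ι h) = _ from (e.symm.map_ι h).symm] at h₂
    exact ((congrArg Sigma.fst h₂).symm.trans (TwoGraph.sigma_edge _ _)).trans
      (congrArg Sigma.fst h₁)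
  refine ⟨⟨p, hp⟩, funext fun i => ?_⟩
  have j := TwoGraph.isoOverEquiv _ K Sigma.fst
    (TwoGraph.sigma_edge fun i => (T i).rep.graph) p hp (Equiv.refl I)
    ⟨e, fun v => congrArg Sigma.fst (e.toV.symm_apply_apply v)⟩ i
  exact ((TwoGraph.sigmaPartIso _ i).trans j).unlabel_eq.symm.trans (unlabel_rep _)

open Classical in
-- Isomorphisms from the disjoint union of the `T i` to `K` are as many as automorphisms of `K`.
-- Each one sends summands to components by some bijection `f`, and a given `f` that matches the
-- classes is induced by ∏ |Aut `T i`| of them.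
theorem card_component_bijections {I : Type} [Fintype I] (T : I → G2) {V H S : Type} [Finite V]
    [Finite H] [Finite S] (K : TwoGraph V H S) (h : ∏ i, T i = K.unlabel)
    (hT : ∀ i, (T i).rep.graph.IsConnected) :
    Nat.card {f : I ≃ K.Component // (fun i => (K.componentGraph (f i)).unlabel) = T} *
      ∏ i, (T i).autCard = Nat.card (K.Iso K) := by
  have := Fintype.ofFinite K.Component
  obtain ⟨e⟩ := exists_sigma_iso T h
  rw [← Nat.card_congr e.autEquiv, Nat.card_congr (TwoGraph.Iso.transEquiv _ e),
    TwoGraph.card_iso_eq_sum (TwoGraph.isComponentMap_sigma hT) K.isComponentMap_toComponent]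
  have key : ∀ f : I ≃ K.Component, ∏ i, Nat.card (((TwoGraph.sigma fun i =>
      (T i).rep.graph).part Sigma.fst (TwoGraph.isComponentMap_sigma hT).edge i).Iso
        (K.part (K.toComponent) K.isComponentMap_toComponent.edge (f i))) =
      if (fun i => (K.componentGraph (f i)).unlabel) = T then ∏ i, (T i).autCard else 0 := by
    intro f
    have h₁ : ∀ i, Nat.card (((TwoGraph.sigma fun i =>
        (T i).rep.graph).part Sigma.fst (TwoGraph.isComponentMap_sigma hT).edge i).Iso
        (K.part (K.toComponent) K.isComponentMap_toComponent.edge (f i))) =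
        if T i = (K.componentGraph (f i)).unlabel then (T i).autCard else 0 := by
      intro i
      rw [TwoGraph.card_iso]
      have h₂ : ((TwoGraph.sigma fun i => (T i).rep.graph).part Sigma.fst
          (TwoGraph.isComponentMap_sigma hT).edge i).unlabel = T i :=
        (TwoGraph.sigmaPartIso _ i).unlabel_eq.symm.trans (unlabel_rep _)
      rw [h₂]
      rfl
    simp_rw [h₁]
    split_ifs with h₃
    · exact Finset.prod_congr rfl fun i _ => if_pos (congrFun h₃ i).symm
    · obtain ⟨i, hi⟩ := Function.ne_iff.1 h₃
      exact Finset.prod_eq_zero (Finset.mem_univ i) (if_neg (Ne.symm hi))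
  simp_rw [key]
  rw [← Finset.sum_filter, Finset.sum_const, smul_eq_mul, Nat.card_eq_fintype_card,
    Fintype.card_subtype]

open Classical in
/-- A product of weighted series over connected 2-graphs is a sum over the ways to distribute the
components to the factors. -/
theorem seriesProd_connected {I : Type} [Fintype I] (a : I → G2 → ℚ) (F : I → Series)
    (hF : ∀ i T, F i T = if T.rep.graph.IsConnected then a i T / T.autCard else 0) {V H S : Type}
    [Finite V] [Finite H] [Finite S] (K : TwoGraph V H S) [Fintype K.Component] :
    seriesProd F K.unlabel =
      (∑ f : I ≃ K.Component, ∏ i, a i (K.componentGraph (f i)).unlabel) /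
        Nat.card (K.Iso K) := by
  have hpos : (Nat.card (K.Iso K) : ℚ) ≠ 0 := Nat.cast_ne_zero.2 K.card_iso_pos.ne'
  -- By `card_component_bijections`, ∏ 1/|Aut `T i`| is the number of bijections that realise `T`,
  -- divided by |Aut `K`|. No bijection realises a `T` with a disconnected member or with the wrong
  -- product, matching the zero terms of the series. The condition `True` only serves to fit
  -- `finsum_card_fiber`.
  have key : ∀ T : I → G2, (∑ᶠ _ : T ∈ {T : I → G2 | ∏ i, T i = K.unlabel}, ∏ i, F i (T i)) =
      ((∏ i, a i (T i)) / Nat.card (K.Iso K)) * (Nat.card {f : I ≃ K.Component //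
        True ∧ (fun i => (K.componentGraph (f i)).unlabel) = T} : ℚ) := by
    intro T
    simp only [true_and, finsum_eq_if, Set.mem_ofPred_eq]
    split_ifs with h
    · by_cases hT : ∀ i, (T i).rep.graph.IsConnected
      · rw [← card_component_bijections T K h hT] at hpos ⊢
        push_cast at hpos ⊢
        have h₁ := left_ne_zero_of_mul hpos
        have h₂ := right_ne_zero_of_mul hpos
        rw [Finset.prod_congr rfl fun i _ => (hF i (T i)).trans (if_pos (hT i)),
          Finset.prod_div_distrib]
        field_simp
      · obtain ⟨i, hi⟩ := not_forall.1 hT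
        rw [Finset.prod_eq_zero (Finset.mem_univ i) ((hF i (T i)).trans (if_neg hi))]
        have : IsEmpty {f : I ≃ K.Component //
            (fun i => (K.componentGraph (f i)).unlabel) = T} := ⟨fun f => hi (by
          rw [← f.2, TwoGraph.isConnected_rep_unlabel]
          exact K.isConnected_componentGraph _)⟩
        rw [Finite.card_eq_zero_iff.2 this, Nat.cast_zero, mul_zero]
    · have : IsEmpty {f : I ≃ K.Component //
          (fun i => (K.componentGraph (f i)).unlabel) = T} := ⟨fun f => h (by
        rw [← f.2, Equiv.prod_comp f.1 fun c => (K.componentGraph c).unlabel,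
          K.prod_unlabel_componentGraph])⟩
      rw [Finite.card_eq_zero_iff.2 this, Nat.cast_zero, mul_zero]
  rw [seriesProd, finsum_congr key, finsum_card_fiber
    (fun (f : I ≃ K.Component) i => (K.componentGraph (f i)).unlabel) (fun _ => True)
    (fun T => (∏ i, a i (T i)) / Nat.card (K.Iso K)), Finset.sum_div,
    ← finsum_eq_sum_of_fintype]
  exact finsum_comp_equiv (Equiv.subtypeUnivEquiv fun _ => trivial)
    (f := fun f : I ≃ K.Component => (∏ i, a i (K.componentGraph (f i)).unlabel) /
      (Nat.card (K.Iso K) : ℚ))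

theorem ComponentClosed.prod_mem_iff {P : Set G2} (hP : ComponentClosed P) {I : Type}
    [Fintype I] (T : I → G2) : ∏ i, T i ∈ P ↔ ∀ i, T i ∈ P := by
  classical
  have key : ∀ s : Finset I, ∏ i ∈ s, T i ∈ P ↔ ∀ i ∈ s, T i ∈ P := by
    intro s
    induction s using Finset.induction_on with
    | empty => simpa using hP.1
    | insert a s ha ih => rw [Finset.prod_insert ha, hP.2, ih, Finset.forall_mem_insert]
  simpa using key Finset.univ

open Classical in
/-- The coefficients of the vertex expansion. -/
theorem vertexExpansion_weighted {P : Set G2} (hP : ComponentClosed P) (A : Set G2)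
    {V H S : Type} [Finite V] [Finite H] [Finite S] (K : TwoGraph V H S) (Γ : G2) :
    vertexExpansion (fun γ => weighted (P ∩ connectedWithBoundary γ)) A K.unlabel Γ =
      if K.unlabel ∈ P ∧ Γ ∈ A then
        (Nat.card {G : TwoGraph V H S // G.ContractsTo K Γ} : ℚ) / Nat.card (K.Iso K)
      else 0 := by
  have := Fintype.ofFinite K.Component
  -- The part of the factor at `v` that remains once connectedness and 1/|Aut `T`| are split off.
  let a : Γ.Vertex → G2 → ℚ := fun v T =>
    if T ∈ P ∧ T.boundary = Γ.vertexGraph v then ((Γ.vertexGraph v).autCard : ℚ) else 0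
  rw [vertexExpansion, seriesProd_connected a]
  swap
  · intro v T
    simp only [Pi.smul_apply, smul_eq_mul, weighted, a, connectedWithBoundary, Set.mem_inter_iff,
      Set.mem_ofPred_eq]
    by_cases h₁ : T ∈ P <;> by_cases h₂ : T.rep.graph.IsConnected <;>
      by_cases h₃ : T.boundary = Γ.vertexGraph v <;> simp [h₁, h₂, h₃, div_eq_mul_inv]
  have hmem := hP.prod_mem_iff fun c => (K.componentGraph c).unlabel
  rw [K.prod_unlabel_componentGraph] at hmem
  by_cases hK : K.unlabel ∈ P
  swap
  -- Some component `c` lies outside `P`, and it kills every product at the vertex to which it is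
  -- assigned.
  · obtain ⟨c, hc⟩ := not_forall.1 (mt hmem.2 hK)
    have : ∀ f : Γ.Vertex ≃ K.Component, ∏ v, a v (K.componentGraph (f v)).unlabel = 0 :=
      fun f => Finset.prod_eq_zero (Finset.mem_univ (f.symm c)) (by
        rw [f.apply_symm_apply]
        exact if_neg fun h => hc h.1)
    simp [this, hK]
  have hcard := K.card_contractsTo_mul_autCard Γ
  rw [TwoGraph.card_sameStars] at hcard
  -- The boundary of a component is the vertex graph of the residue at that component, so the factor
  -- counts isomorphisms of vertex graphs. Their products sum to the number of star-preserving
  -- bijections in `hcard`, whose factor |Aut Γ| cancels the weight of Γ.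
  have ha : ∀ (f : Γ.Vertex ≃ K.Component) v, a v (K.componentGraph (f v)).unlabel =
      (Nat.card ((Γ.rep.graph.vertexGraph v).Iso (K.residue.vertexGraph (f v))) : ℚ) := by
    intro f v
    rw [OneGraph.card_iso, ← OneGraph.unlabel_eq_iff.2 ⟨K.componentBoundaryIso (f v)⟩,
      ← TwoGraph.boundary_unlabel, Nat.cast_ite, Nat.cast_zero]
    exact if_congr ⟨fun h => h.2.symm, fun h => ⟨hmem.1 hK _, h.symm⟩⟩ rfl rfl
  simp_rw [ha]
  have hcard' := congrArg (Nat.cast (R := ℚ)) hcard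
  push_cast at hcard'
  rw [← hcard', weighted]
  have h₁ : (Γ.autCard : ℚ) ≠ 0 := Nat.cast_ne_zero.2 Γ.autCard_pos.ne'
  by_cases hΓ : Γ ∈ A
  · simp only [hΓ, hK, and_self, if_true]
    field_simp
  · simp [hΓ]

/-! ### The central identity -/

/-- The central identity holds at `K ⊗ Γ` iff membership of `A` is not affected by insertion of
`K` into `Γ`. -/
theorem coeff_eq_iff {P : Set G2} (hP : ComponentClosed P) (A : Set G2) {V H S : Type} [Finite V]
    [Finite H] [Finite S] (K : TwoGraph V H S) (Γ : G2) :
    applySeries (coproductOn P) (weighted A) K.unlabel Γ =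
        vertexExpansion (fun γ => weighted (P ∩ connectedWithBoundary γ)) A K.unlabel Γ ↔
      (K.unlabel ∈ P → ∀ G : TwoGraph V H S, G.ContractsTo K Γ → (G.unlabel ∈ A ↔ Γ ∈ A)) := by
  classical
  rw [applySeries_coproductOn, vertexExpansion_weighted hP]
  have hpos : (Nat.card (K.Iso K) : ℚ) ≠ 0 := Nat.cast_ne_zero.2 K.card_iso_pos.ne'
  by_cases hK : K.unlabel ∈ P
  swap
  · simp [hK]
  simp only [hK, if_true, true_and, forall_const]
  -- The number of `G` with class in `A` is compared with the number of all `G` if Γ is in `A`, and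
  -- with 0 otherwise. In the first case equality of finite cardinalities makes the subset
  -- everything, in the second it makes it empty.
  by_cases hΓ : Γ ∈ A
  · simp only [hΓ, if_true, iff_true]
    rw [div_left_inj' hpos, Nat.cast_inj]
    constructor
    · intro h G hG
      have hinj : Function.Injective fun G : {G : TwoGraph V H S //
          G.ContractsTo K Γ ∧ G.unlabel ∈ A} =>
            (⟨G.1, G.2.1⟩ : {G : TwoGraph V H S // G.ContractsTo K Γ}) :=
        fun _ _ h => Subtype.ext (congrArg (fun x => x.1) h)
      obtain ⟨G', hG'⟩ := ((Nat.bijective_iff_injective_and_card _).2 ⟨hinj, h⟩).2 ⟨G, hG⟩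
      rw [← show G'.1 = G from congrArg Subtype.val hG']
      exact G'.2.2
    · intro h
      exact Nat.card_congr (Equiv.subtypeEquivRight fun G => and_iff_left_of_imp (h G))
  · simp only [hΓ, if_false, iff_false, div_eq_zero_iff, hpos, or_false, Nat.cast_eq_zero]
    rw [Finite.card_eq_zero_iff, isEmpty_subtype]
    exact forall_congr' fun G => not_and

/-- Each pair of `G` and a subgraph `Θ` in `P` is tested by the coefficient at `Θ` ⊗ `G/Θ`;
conversely every coefficient can be evaluated on a labelled representative of its first index. -/
theorem central_identity_iff {P : Set G2} (hP : ComponentClosed P) (A : Set G2) :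
    applySeries (coproductOn P) (weighted A) =
        vertexExpansion (fun γ => weighted (P ∩ connectedWithBoundary γ)) A ↔
      ContractionClosed P A ∧ InsertionClosed P A := by
  constructor
  · intro h
    have key : ∀ (G : FinTwoGraph) (Θ : G.graph.Subgraph), Θ.1.unlabel ∈ P →
        (G.graph.unlabel ∈ A ↔ (G.graph.contract Θ.1 Θ.2).unlabel ∈ A) := fun G Θ hΘ =>
      (coeff_eq_iff hP A Θ.1 (G.graph.contract Θ.1 Θ.2).unlabel).1
        (congrFun (congrFun h _) _) hΘ G.graph ⟨Θ.2, rfl⟩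
    exact ⟨fun G Θ hΘ => (key G Θ hΘ).1, fun G Θ hΘ => (key G Θ hΘ).2⟩
  · rintro ⟨hc, hi⟩
    funext Θ Γ
    rw [← unlabel_rep Θ, coeff_eq_iff hP]
    rintro hΘ G ⟨hK, rfl⟩
    exact ⟨hc ⟨_, _, _, G⟩ ⟨_, hK⟩ hΘ, hi ⟨_, _, _, G⟩ ⟨_, hK⟩ hΘ⟩

end G2

/-! ### Bridges -/

/-- Two vertices are joined by edges other than that of `h`. -/
def OneGraph.joinedAvoiding {V H : Type} (g : OneGraph V H) (h : H) : Setoid V :=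
  Relation.EqvGen.setoid fun v w => ∃ k, k ≠ h ∧ k ≠ g.ι h ∧ g.ν k = v ∧ g.ν (g.ι k) = w

theorem OneGraph.isBridge_iff {V H : Type} {g : OneGraph V H} {h : H} :
    g.IsBridge h ↔ g.ι h ≠ h ∧ ¬ g.joinedAvoiding h (g.ν h) (g.ν (g.ι h)) :=
  Iff.rfl

theorem OneGraph.joinedAvoiding_edge {V H : Type} (g : OneGraph V H) {h k : H} (h₁ : k ≠ h)
    (h₂ : k ≠ g.ι h) : g.joinedAvoiding h (g.ν k) (g.ν (g.ι k)) :=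
  Relation.EqvGen.rel _ _ ⟨k, h₁, h₂, rfl, rfl⟩

theorem OneGraph.joinedAvoiding_lift {V H β : Type} {g : OneGraph V H} {h : H} {v w : V}
    (hvw : g.joinedAvoiding h v w) (s : Setoid β) (f : V → β)
    (hs : ∀ k, k ≠ h → k ≠ g.ι h → s (f (g.ν k)) (f (g.ν (g.ι k)))) : s (f v) (f w) :=
  Relation.EqvGen.lift_setoid s f (by rintro _ _ ⟨k, h₁, h₂, rfl, rfl⟩; exact hs k h₁ h₂) hvw

namespace TwoGraph

variable {V H S V' H' S' : Type}

/-- Bridges are not affected by the inclusion into a disjoint union: `r` sends the vertices of the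
complement to `none`. -/
theorem isBridge_embedding {G : TwoGraph V H S} {G' : TwoGraph V' H' S'} (jV : V → V')
    (jH : H → H') (hjH : Function.Injective jH) (hν : ∀ h, G'.ν (jH h) = jV (G.ν h))
    (hι : ∀ h, G'.ι (jH h) = jH (G.ι h)) (r : V' → Option V) (hr : ∀ v, r (jV v) = some v)
    (hc : ∀ k, (∃ h, jH h = k) ∨ r (G'.ν k) = none ∧ r (G'.ν (G'.ι k)) = none) (h : H) :
    G'.IsBridge (jH h) ↔ G.IsBridge h := by
  rw [OneGraph.isBridge_iff, OneGraph.isBridge_iff, hι, hjH.ne_iff, hν, hν]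
  refine and_congr_right fun _ => not_congr ⟨fun hj => ?_, fun hj => ?_⟩
  -- All vertices outside the embedded graph share the value `none`. No edge joins them to the
  -- embedded part, so `f` is constant along every edge other than that of `h`.
  · let f : V' → Option (Quotient (G.joinedAvoiding h)) := fun v' =>
      (r v').map (Quotient.mk (G.joinedAvoiding h))
    have : f (jV (G.ν h)) = f (jV (G.ν (G.ι h))) :=
      OneGraph.joinedAvoiding_lift hj (⊥ : Setoid (Option (Quotient (G.joinedAvoiding h)))) f
        fun k h₁ h₂ => by
          rcases hc k with ⟨k, rfl⟩ | ⟨h₃, h₄⟩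
          · show f _ = f _
            simp only [f, hν, hι, hr, Option.map_some]
            rw [hι, hjH.ne_iff] at h₂
            exact congrArg some
              (Quotient.sound (G.joinedAvoiding_edge (fun e => h₁ (e ▸ rfl)) h₂))
          · show f _ = f _
            simp only [f, h₃, h₄]
    simp only [f, hr, Option.map_some, Option.some.injEq] at this
    exact Quotient.exact this
  · refine OneGraph.joinedAvoiding_lift hj (G'.joinedAvoiding (jH h)) jV fun k h₁ h₂ => ?_
    rw [← hν, ← hν, ← hι]
    exact G'.joinedAvoiding_edge (hjH.ne h₁) (by rw [hι]; exact hjH.ne h₂)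

theorem Iso.isBridge_iff {G : TwoGraph V H S} {G' : TwoGraph V' H' S'} (i : G.Iso G') (h : H) :
    G'.IsBridge (i.toH h) ↔ G.IsBridge h :=
  isBridge_embedding i.toV i.toH i.toH.injective i.map_ν i.map_ι (fun v => some (i.toV.symm v))
    (by simp) (fun k => Or.inl (i.toH.surjective k)) h

theorem isBridge_disjUnion_inl (G : TwoGraph V H S) (G' : TwoGraph V' H' S') (h : H) :
    (G.disjUnion G').IsBridge (Sum.inl h) ↔ G.IsBridge h :=
  isBridge_embedding Sum.inl Sum.inl Sum.inl_injective (fun _ => rfl) (fun _ => rfl)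
    (Sum.elim some fun _ => none) (fun _ => rfl)
    (by rintro (k | k); exacts [Or.inl ⟨k, rfl⟩, Or.inr ⟨rfl, rfl⟩]) h

theorem isBridge_disjUnion_inr (G : TwoGraph V H S) (G' : TwoGraph V' H' S') (h : H') :
    (G.disjUnion G').IsBridge (Sum.inr h) ↔ G'.IsBridge h :=
  isBridge_embedding Sum.inr Sum.inr Sum.inr_injective (fun _ => rfl) (fun _ => rfl)
    (Sum.elim (fun _ => none) some) (fun _ => rfl)
    (by rintro (k | k); exacts [Or.inr ⟨rfl, rfl⟩, Or.inl ⟨k, rfl⟩]) h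

section Contract

variable {G K : TwoGraph V H S}

/-- The edge of `h` is not in `K`, so the vertices identified by the contraction are already joined
in `G` by edges other than this one. -/
theorem contract_isBridge_iff [Finite S] (hK : K.IsSubgraph G) {h : H} (hh : K.ι h = h) :
    (G.contract K hK).IsBridge ⟨h, hh⟩ ↔ G.IsBridge h := by
  have hKG : ∀ {v w}, K.joined v w → G.joinedAvoiding h v w := fun hvw =>
    OneGraph.joined_lift hvw (G.joinedAvoiding h) id fun k => by
      by_cases hk : K.ι k = k
      · rw [hk]
      · rw [hK.ι_eq k hk, hK.ν_eq]
        exact G.joinedAvoiding_edge (fun e => hk (e ▸ hh))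
          fun e => hk (e ▸ hK.ι_external hh)
  rw [OneGraph.isBridge_iff, OneGraph.isBridge_iff]
  refine and_congr (not_congr Subtype.ext_iff) (not_congr ⟨fun hj => ?_, fun hj => ?_⟩)
  · let f : K.Component → Quotient (G.joinedAvoiding h) := Quotient.map id fun _ _ h => hKG h
    have := OneGraph.joinedAvoiding_lift hj (⊥ : Setoid (Quotient (G.joinedAvoiding h))) f
      fun k h₁ h₂ => by
        refine Quotient.sound ?_
        show G.joinedAvoiding h (K.ν k) (K.ν (G.ι k))
        rw [hK.ν_eq]
        exact G.joinedAvoiding_edge (fun e => h₁ (Subtype.ext e)) fun e => h₂ (Subtype.ext e)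
    have := Quotient.exact this
    change G.joinedAvoiding h (K.ν h) (K.ν (G.ι h)) at this
    rwa [hK.ν_eq] at this
  · rw [← hK.ν_eq] at hj
    refine OneGraph.joinedAvoiding_lift hj ((G.contract K hK).joinedAvoiding ⟨h, hh⟩)
      K.toComponent fun k h₁ h₂ => ?_
    by_cases hk : K.ι k = k
    · have := (G.contract K hK).joinedAvoiding_edge (h := ⟨h, hh⟩) (k := ⟨k, hk⟩)
        (fun e => h₁ (congrArg Subtype.val e)) fun e => h₂ (congrArg Subtype.val e)
      change (G.contract K hK).joinedAvoiding ⟨h, hh⟩ (K.toComponent (K.ν k))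
        (K.toComponent (K.ν (G.ι k))) at this
      rwa [hK.ν_eq] at this
    · have : K.toComponent (G.ν k) = K.toComponent (G.ν (G.ι k)) := by
        rw [← hK.ν_eq, ← hK.ι_eq k hk]
        exact Quotient.sound (K.joined_edge k)
      rw [this]

/-- With fewer edges there are fewer ways around `h`. -/
theorem IsSubgraph.isBridge (hK : K.IsSubgraph G) {h : H} (hh : K.ι h ≠ h)
    (hb : G.IsBridge h) : K.IsBridge h := by
  rw [OneGraph.isBridge_iff] at hb ⊢
  refine ⟨hh, fun hj => hb.2 ?_⟩
  rw [← hK.ι_eq h hh, ← hK.ν_eq]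
  refine OneGraph.joinedAvoiding_lift hj (G.joinedAvoiding h) id fun k h₁ h₂ => ?_
  by_cases hk : K.ι k = k
  · rw [hk]
  · rw [hK.ι_eq k hk, hK.ν_eq]
    exact G.joinedAvoiding_edge h₁ (by rwa [← hK.ι_eq h hh])

/-- A bridge of `G` inside `K` would be a bridge of `K`; any other one persists in the contraction,
and all bridges of the contraction arise in this way. -/
theorem bridgeless_contract_iff [Finite S] (hK : K.IsSubgraph G) (hb : ∀ h, ¬ K.IsBridge h) :
    (∀ h, ¬ (G.contract K hK).IsBridge h) ↔ ∀ h, ¬ G.IsBridge h := by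
  constructor
  · intro H h hG
    by_cases hh : K.ι h = h
    · exact H ⟨h, hh⟩ ((contract_isBridge_iff hK hh).2 hG)
    · exact hb h (hK.isBridge hh hG)
  · exact fun H h hG => H h ((contract_isBridge_iff hK h.2).1 hG)

/-- Vertex graphs do not depend on the edges. -/
def IsSubgraph.vertexGraphIso (hK : K.IsSubgraph G) (v : V) :
    (K.vertexGraph v).Iso (G.vertexGraph v) where
  toV := Equiv.subtypeEquivRight fun h => by rw [hK.ν_eq]
  toH := Equiv.subtypeEquivRight fun s => by rw [hK.ν_eq, hK.μ_eq]
  map_ν s := Subtype.ext (congrFun hK.μ_eq s.1).symm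
  map_ι s := Subtype.ext (congrFun hK.σ₁_eq s.1).symm

end Contract

/-- The fibers of a map of disjoint unions. -/
noncomputable def fiberEmbeddingEquiv {A C I L : Type} {p : A → I} {r : C → L} {j : A → C}
    {k : I → L} (hj : Function.Injective j) (hk : Function.Injective k)
    (h : ∀ a, r (j a) = k (p a)) (i : I) (hr : ∀ c, r c = k i → ∃ a, j a = c) :
    {a // p a = i} ≃ {c // r c = k i} :=
  Equiv.ofBijective (fun a => ⟨j a.1, by rw [h, a.2]⟩)
    ⟨fun a b hab => Subtype.ext (hj (congrArg Subtype.val hab)), fun c => by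
      obtain ⟨a, ha⟩ := hr c.1 c.2
      exact ⟨⟨a, hk (by rw [← h, ha, c.2])⟩, Subtype.ext ha⟩⟩

/-- The vertex graphs of a disjoint union. -/
noncomputable def vertexGraphInlIso (G : TwoGraph V H S) (G' : TwoGraph V' H' S') (v : V) :
    (G.vertexGraph v).Iso ((G.disjUnion G').vertexGraph (Sum.inl v)) where
  toV := fiberEmbeddingEquiv (p := G.ν) (r := (G.disjUnion G').ν) Sum.inl_injective
    Sum.inl_injective (fun _ => rfl) v (by rintro (h | h) e; exacts [⟨h, rfl⟩, (Sum.inr_ne_inl e).elim])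
  toH := fiberEmbeddingEquiv (p := fun s => G.ν (G.μ s))
    (r := fun s => (G.disjUnion G').ν ((G.disjUnion G').μ s)) Sum.inl_injective Sum.inl_injective
    (fun _ => rfl) v (by rintro (h | h) e; exacts [⟨h, rfl⟩, (Sum.inr_ne_inl e).elim])
  map_ν _ := rfl
  map_ι _ := rfl

/-- The vertex graphs of a disjoint union. -/
noncomputable def vertexGraphInrIso (G : TwoGraph V H S) (G' : TwoGraph V' H' S') (v : V') :
    (G'.vertexGraph v).Iso ((G.disjUnion G').vertexGraph (Sum.inr v)) where
  toV := fiberEmbeddingEquiv (p := G'.ν) (r := (G.disjUnion G').ν) Sum.inr_injective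
    Sum.inr_injective (fun _ => rfl) v (by rintro (h | h) e; exacts [(Sum.inl_ne_inr e).elim, ⟨h, rfl⟩])
  toH := fiberEmbeddingEquiv (p := fun s => G'.ν (G'.μ s))
    (r := fun s => (G.disjUnion G').ν ((G.disjUnion G').μ s)) Sum.inr_injective Sum.inr_injective
    (fun _ => rfl) v (by rintro (h | h) e; exacts [(Sum.inl_ne_inr e).elim, ⟨h, rfl⟩])
  map_ν _ := rfl
  map_ι _ := rfl

variable [Finite V] [Finite H] [Finite S]

theorem unlabel_mem_bridgeless (G : TwoGraph V H S) :
    G.unlabel ∈ G2.bridgeless ↔ ∀ h, ¬ G.IsBridge h := by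
  obtain ⟨i⟩ := G2.exists_iso_rep G
  exact ⟨fun h k hk => h _ ((i.isBridge_iff k).2 hk),
    fun h k hk => h _ ((i.symm.isBridge_iff k).2 hk)⟩

theorem unlabel_mem_withVertexGraphs (W : Set G1) (G : TwoGraph V H S) :
    G.unlabel ∈ G2.withVertexGraphs W ↔ ∀ v, (G.vertexGraph v).unlabel ∈ W := by
  obtain ⟨i⟩ := G2.exists_iso_rep G
  constructor
  · intro h v
    rw [OneGraph.unlabel_eq_iff.2 ⟨i.vertexGraph v⟩]
    exact h (i.toV v)
  · intro h v
    have := h (i.symm.toV v)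
    rwa [← OneGraph.unlabel_eq_iff.2 ⟨i.symm.vertexGraph v⟩] at this

end TwoGraph

/-! ### Closure properties of the special families -/

namespace G2

open TwoGraph

theorem componentClosed_univ : ComponentClosed Set.univ :=
  ⟨trivial, fun _ _ => ⟨fun _ => ⟨trivial, trivial⟩, fun _ => trivial⟩⟩

theorem componentClosed_bridgeless : ComponentClosed bridgeless := by
  constructor
  · rw [one_eq_unlabel, unlabel_mem_bridgeless]
    exact fun h => h.elim
  · intro Γ Γ'
    rw [← unlabel_rep Γ, ← unlabel_rep Γ', unlabel_mul_unlabel, unlabel_mem_bridgeless,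
      unlabel_mem_bridgeless, unlabel_mem_bridgeless, Sum.forall]
    simp only [isBridge_disjUnion_inl, isBridge_disjUnion_inr]

theorem componentClosed_withVertexGraphs (W : Set G1) : ComponentClosed (withVertexGraphs W) := by
  constructor
  · rw [one_eq_unlabel, unlabel_mem_withVertexGraphs]
    exact fun v => v.elim
  · intro Γ Γ'
    rw [← unlabel_rep Γ, ← unlabel_rep Γ', unlabel_mul_unlabel, unlabel_mem_withVertexGraphs,
      unlabel_mem_withVertexGraphs, unlabel_mem_withVertexGraphs, Sum.forall]
    refine and_congr (forall_congr' fun v => ?_) (forall_congr' fun v => ?_)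
    · rw [OneGraph.unlabel_eq_iff.2 ⟨vertexGraphInlIso Γ.rep.graph Γ'.rep.graph v⟩]
    · rw [OneGraph.unlabel_eq_iff.2 ⟨vertexGraphInrIso Γ.rep.graph Γ'.rep.graph v⟩]

theorem contract_mem_connectedWithBoundary_iff (γ : G1) (G : FinTwoGraph)
    (Θ : G.graph.Subgraph) : (G.graph.contract Θ.1 Θ.2).unlabel ∈ connectedWithBoundary γ ↔
      G.graph.unlabel ∈ connectedWithBoundary γ := by
  rw [unlabel_mem_connectedWithBoundary, unlabel_mem_connectedWithBoundary,
    contract_isConnected_iff, OneGraph.unlabel_eq_iff.2 ⟨contractBoundaryIso Θ.2⟩]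

theorem contract_mem_bridgeless_iff (G : FinTwoGraph) (Θ : G.graph.Subgraph)
    (hΘ : Θ.1.unlabel ∈ bridgeless) :
    (G.graph.contract Θ.1 Θ.2).unlabel ∈ bridgeless ↔ G.graph.unlabel ∈ bridgeless := by
  rw [unlabel_mem_bridgeless] at hΘ
  rw [unlabel_mem_bridgeless, unlabel_mem_bridgeless, bridgeless_contract_iff Θ.2 hΘ]

/-- Vertex graphs involve only ν, μ and σ₁, which a subgraph shares with the whole. This gives
insertion closure without any hypothesis on `W`. -/
theorem subgraph_mem_withVertexGraphs_iff (W : Set G1) {V H S : Type} [Finite V] [Finite H]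
    [Finite S] {G K : TwoGraph V H S} (hK : K.IsSubgraph G) :
    K.unlabel ∈ withVertexGraphs W ↔ G.unlabel ∈ withVertexGraphs W := by
  rw [unlabel_mem_withVertexGraphs, unlabel_mem_withVertexGraphs]
  refine forall_congr' fun v => ?_
  rw [OneGraph.unlabel_eq_iff.2 ⟨hK.vertexGraphIso v⟩]

/-- Only subgraphs with vertex graphs in `W` contribute to the coproduct of 2-graphs with vertex
graphs in `W`. -/
theorem applySeries_coproduct_withVertexGraphs (W : Set G1) :
    applySeries coproduct (weighted (withVertexGraphs W)) =
      applySeries (coproductOn (withVertexGraphs W)) (weighted (withVertexGraphs W)) := by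
  classical
  funext Θ Γ
  rw [← unlabel_rep Θ, coproduct, applySeries_coproductOn, applySeries_coproductOn,
    if_pos (Set.mem_univ _)]
  split_ifs with h
  · rfl
  · have : IsEmpty {G : TwoGraph Θ.rep.V Θ.rep.H Θ.rep.S //
        G.ContractsTo Θ.rep.graph Γ ∧ G.unlabel ∈ withVertexGraphs W} :=
      ⟨fun G => h ((subgraph_mem_withVertexGraphs_iff W G.2.1.1).2 G.2.2)⟩
    rw [Finite.card_eq_zero_iff.2 this, Nat.cast_zero, zero_div]

end G2

open G2 in
theorem theorem1 :
    -- the sums below that define coefficients of formal series are all finite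
    (∀ (P : Set G2) (Θ Γ' : G2),
      {Γ : G2 | tensorCoeff Θ Γ' (coproductOn P (MonoidAlgebra.single Γ (1 : ℚ))) ≠ 0}.Finite) ∧
    (∀ (I : Type) [Fintype I] (Θ : G2), {T : I → G2 | ∏ i, T i = Θ}.Finite) ∧
    -- the central identity for the series over all 2-graphs
    applySeries coproduct (weighted Set.univ) =
      vertexExpansion (fun γ => weighted (connectedWithBoundary γ)) Set.univ ∧
    -- the same for the series over connected 2-graphs with given boundary
    (∀ γ₀ : G1, applySeries coproduct (weighted (connectedWithBoundary γ₀)) =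
      vertexExpansion (fun γ => weighted (connectedWithBoundary γ))
        (connectedWithBoundary γ₀)) ∧
    -- the same for bridgeless 2-graphs, with their restricted coproduct
    applySeries (coproductOn bridgeless) (weighted bridgeless) =
      vertexExpansion (fun γ => weighted (bridgeless ∩ connectedWithBoundary γ)) bridgeless ∧
    -- the same for 2-graphs with vertex graphs in `W`, when these are closed under contraction
    (∀ W : Set G1, ContractionClosed Set.univ (withVertexGraphs W) →
      applySeries coproduct (weighted (withVertexGraphs W)) =
        vertexExpansion (fun γ => weighted (withVertexGraphs W ∩ connectedWithBoundary γ))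
          (withVertexGraphs W)) ∧
    -- the restrictions for which the formula holds
    (∀ P K : Set G2, ComponentClosed P →
      (applySeries (coproductOn P) (weighted K) =
          vertexExpansion (fun γ => weighted (P ∩ connectedWithBoundary γ)) K ↔
        ContractionClosed P K ∧ InsertionClosed P K)) := by
  refine ⟨finite_tensorCoeff_ne_zero, fun I _ Θ => finite_prod_eq I Θ, ?_, fun γ₀ => ?_, ?_,
    fun W hW => ?_, fun P K hP => central_identity_iff hP K⟩
  · have h := (central_identity_iff componentClosed_univ Set.univ).2
      ⟨fun _ _ _ _ => trivial, fun _ _ _ _ => trivial⟩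
    simp only [Set.univ_inter] at h
    exact h
  · have h := (central_identity_iff componentClosed_univ (connectedWithBoundary γ₀)).2
      ⟨fun G Θ _ => (contract_mem_connectedWithBoundary_iff γ₀ G Θ).2,
        fun G Θ _ => (contract_mem_connectedWithBoundary_iff γ₀ G Θ).1⟩
    simp only [Set.univ_inter] at h
    exact h
  · exact (central_identity_iff componentClosed_bridgeless bridgeless).2
      ⟨fun G Θ h => (contract_mem_bridgeless_iff G Θ h).2,
        fun G Θ h => (contract_mem_bridgeless_iff G Θ h).1⟩
  -- Taking `P` to be the family itself produces the restricted series at the vertices and makes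
  -- insertion closure automatic; only contraction closure uses `hW`.
  · rw [applySeries_coproduct_withVertexGraphs]
    exact (central_identity_iff (componentClosed_withVertexGraphs W) _).2
      ⟨fun G Θ _ => hW G Θ trivial,
        fun G Θ h _ => (subgraph_mem_withVertexGraphs_iff W Θ.2).1 h⟩
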